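/- Conventions. Let $A=\{1,\dots,\mathcal K\}$, $\Omega=[0,1]$, and let $\lambda$ be the Lebesgue measure on $\Omega$. A \emph{topological Markov expanding map} with monotonicity intervals $I_j=]\eta_{j-1},\eta_j[$, where $0=\eta_0<\dots<\eta_{\mathcal K}=1$, is a map $T:\Omega\setminus\{\eta_0,\dots,\eta_{\mathcal K}\}\to\Omega$ such that each $T|_{I_j}$ is monotone and extends to a $C^2$ map on $\bar I_j$; for some $m\ge 1$ and $c>1$ one has $|(T^m)'|\ge c$ wherever $T^m$ is defined and differentiable; and the closure of each $T(I_i)$ is a union of closures of intervals $I_j$. For a point $\omega$ whose orbit never meets $\{\eta_0,\dots,\eta_{\mathcal K}\}$, its code $W(\omega)$ is given by $W_n(\omega)=j$ iff $T^n(\omega)\in I_j$. For a finite string $x_{-k}^{-1}$ we write $\lambda(C(x_{-k}^{-1}))=\lambda\{\omega: W_0^{k-1}(\omega)=(x_{-1},\dots,x_{-k})\}$. The chain associated with $T$ (when $\lambda$ is $T$-invariant) is the stationary process with law $\mathbb P$ on $A^{\mathbb Z}$ such that $\mathbb P(X_m^n=x_m^n)=\lambda\{\omega: W_0^{n-m}(\omega)=(x_n,\dots,x_m)\}$.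 A \emph{context tree} is a set $\tau$ of finite strings $x_{-k}^{-1}$ ($k\ge1$) and infinite strings $x_{-\infty}^{-1}$ over $A$ whose cylinders $C(w)$ (the set of pasts $x_{-\infty}^{-1}$ ending with $w$), $w\in\tau$, form a partition of $A_{-\infty}^{-1}$. A family of transition probabilities is a family of measurable functions $x_{-\infty}^{-1}\mapsto p(a|x_{-\infty}^{-1})\in[0,1]$, $a\in A$, with $\sum_a p(a|x_{-\infty}^{-1})=1$. It has \emph{variable length} with context tree $\tau$ if for each $w\in\tau$ there is a probability $q(\cdot|w)$ on $A$ with $p(a|x_{-\infty}^{-1})=q(a|w)$ for all $x_{-\infty}^{-1}\in C(w)$ and $a\in A$. A law $\mathbb P$ on $A^{\mathbb Z}$ is invariant for $p$ if $\int f(z_{-\infty}^0)\,d\mathbb P=\int\sum_a p(a|z_{-\infty}^{-1})f(z_{-\infty}^{-1}a)\,d\mathbb P$ for every continuous $f$. The contexts are almost surely finite if $\mathbb P$-almost every past $z_{-\infty}^{-1}$ lies in $C(w)$ for some finite $w\in\tau$. Property (V), for a map $T$ with intervals $I_j$ and a context tree $\tau$: $$\sum_{k\ge1}\ \sum_{x_{-k}^{-1}\in\tau}\lambda\big(C(x_{-k}^{-1})\big)=1,$$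 and for every finite $x_{-k}^{-1}\in\tau$, every $a\in A$ and all $\omega,\omega'$ with $W_0^k(\omega)=W_0^k(\omega')=(a,x_{-1},\dots,x_{-k})$ one has $T'(\omega)=T'(\omega')$. Theorem. (1) Let $T$ be a topological Markov expanding map for which $\lambda$ is invariant and ergodic, and let $\tau$ be a context tree for which $T$ has property (V). Then the chain associated with $T$ exists, and its law $\mathbb P$ is stationary and invariant for a family of transition probabilities $p$ such that: (a) for every past $a_{-\infty}^{-1}$ all of whose finite strings $(a_{-1},\dots,a_{-n})$ begin the code of some point, and every $b\in A$: $p(b|a_{-\infty}^{-1})=\lim_n 1/|T'(\omega_n)|$ for every choice of points $\omega_n$ with $W_0^n(\omega_n)=(b,a_{-1},\dots,a_{-n})$, and $p(b|a_{-\infty}^{-1})=0$ if for some $n$ no point has such a code; (b) $p$ has variable length with context tree $\tau$, and the contexts are $\mathbb P$-almost surely finite. (2) Conversely, let $\mathcal K\ge2$, let $p$ be a non-null family of transition probabilities (that is, $\inf p>0$) which has variable length with context tree $\tau$, and let $\mathbb P$ be a stationary probability measure on $A^{\mathbb Z}$ invariant for $p$ for which the contexts are almost surely finite. Order $A_{-\infty}^0$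 lexicographically, comparing first the symbols at position $0$, then at position $-1$, and so on, and let $h(x)=\mathbb P(z_{-\infty}^0\le x)$. Let $\mathscr Q$ be the countable set of $x\in A_{-\infty}^0$ for which there is $m\ge0$ such that either $x_{-m}\ne\mathcal K$ and $x_{-n}=\mathcal K$ for all $n>m$, or $x_{-m}\neq1$ and $x_{-n}=1$ for all $n>m$. Let $\eta_0=0$, $\eta_k=h(\cdots\mathcal K\mathcal K k)$ and $I_k=]\eta_{k-1},\eta_k[$ for $1\le k\le\mathcal K$. Then $0=\eta_0<\dots<\eta_{\mathcal K}=1$, and the map given by $T(h(x))=h(\dots x_{-2}x_{-1})$ for $x\notin\mathscr Q$ extends to a map $T$ that is continuous on each $I_j$. Every such $T$ is strictly increasing on each $I_j$. It is piecewise affine: there are disjoint non-empty open intervals $U_{a,w}\subset\Omega$, indexed by $a\in A$ and the finite $w\in\tau$, which cover $\Omega$ up to a Lebesgue null set and on each of which $T$ is affine. Finally, $T$ is differentiable at every point whose code starts with $a,x_{-1},\dots,x_{-k}$ for some $a\in A$ and finite $x_{-k}^{-1}\in\tau$, and $T$ has property (V) for $\tau$. -/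

import Mathlib

open Set Filter Topology MeasureTheory

noncomputable section

namespace VLChain

/-! ### Symbols, pasts and strings

The alphabet is `Fin K`.  A past `x_{-∞}^{0}` is a function `x : ℕ → Fin K`, where `x n` is the symbol at
position `-n`; a past `x_{-∞}^{-1}` is a function `x : ℕ → Fin K`, where `x n` is the symbol at position
`-(n+1)`.  A finite string is a list whose head is its most recent symbol, so that
"having `w` as final sequence" reads "having the list `w` as initial segment". -/

/-- A one-sided infinite past. -/
abbrev Past (K : ℕ) : Type := ℕ → Fin K

/-- The past `x a`, obtained by adding the most recent symbol `a` to `x`. -/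
def consPast {K : ℕ} (a : Fin K) (x : Past K) : Past K
  | 0 => a
  | n + 1 => x n

/-- The shift on pasts: forget the most recent symbol. -/
def shiftPast {K : ℕ} (x : Past K) : Past K := fun n => x (n + 1)

/-- The `n` most recent symbols of a past, most recent first. -/
def recent {K : ℕ} (x : Past K) (n : ℕ) : List (Fin K) := List.ofFn fun i : Fin n => x i

/-- Finite strings (left) and infinite strings (right). -/
abbrev PastString (K : ℕ) : Type := List (Fin K) ⊕ Past K

/-- `C(w)`: the set of pasts having the string `w` as final sequence. -/
def cyl {K : ℕ} : PastString K → Set (Past K)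
  | Sum.inl w => {x | ∀ (i : ℕ) (hi : i < w.length), x i = w[i]}
  | Sum.inr y => {y}

/-- Context trees: sets of finite strings of length at least one and of infinite strings, whose
cylinders form a partition of the set of pasts. -/
structure IsContextTree {K : ℕ} (τ : Set (PastString K)) : Prop where
  length_pos : ∀ w : List (Fin K), Sum.inl w ∈ τ → 1 ≤ w.length
  cover : ⋃ w ∈ τ, cyl w = univ
  disjoint : ∀ w ∈ τ, ∀ w' ∈ τ, w ≠ w' → cyl w ∩ cyl w' = ∅

/-! ### Chains of infinite order -/

/-- `p a x` stands for `p(a | x_{-∞}^{-1})`. -/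
structure IsTransitionFamily {K : ℕ} (p : Fin K → Past K → ℝ) : Prop where
  mem_Icc : ∀ a x, p a x ∈ Icc (0 : ℝ) 1
  sum_eq_one : ∀ x, ∑ a, p a x = 1
  measurable : ∀ a, Measurable (p a)

/-- Non-nullness: the transition probabilities have a positive infimum. -/
def NonNull {K : ℕ} (p : Fin K → Past K → ℝ) : Prop :=
  ∃ ε : ℝ, 0 < ε ∧ ∀ a x, ε ≤ p a x

/-- The transition probabilities are those of a probabilistic context tree `(τ, q)`. -/
def HasVariableLength {K : ℕ} (τ : Set (PastString K)) (p : Fin K → Past K → ℝ) : Prop :=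
  ∃ q : τ → PMF (Fin K), ∀ (w : τ) (x : Past K), x ∈ cyl w.1 → ∀ a, p a x = (q w a).toReal

/-- `z_{-∞}^{0}`. -/
def past0 {K : ℕ} (z : ℤ → Fin K) : Past K := fun n => z (-(n : ℤ))

/-- `z_{-∞}^{-1}`. -/
def past1 {K : ℕ} (z : ℤ → Fin K) : Past K := fun n => z (-(n : ℤ) - 1)

/-- The law `P` on `A^ℤ` is invariant under the shift. -/
def Stationary {K : ℕ} (P : Measure (ℤ → Fin K)) : Prop :=
  MeasurePreserving (fun (z : ℤ → Fin K) (i : ℤ) => z (i - 1)) P P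

/-- The law `P` on `A^ℤ` is invariant with respect to the transition probabilities `p`. -/
def InvariantFor {K : ℕ} (p : Fin K → Past K → ℝ) (P : Measure (ℤ → Fin K)) : Prop :=
  ∀ f : Past K → ℝ, Continuous f →
    ∫ z, f (past0 z) ∂P = ∫ z, ∑ a, p a (past1 z) * f (consPast a (past1 z)) ∂P

/-- Under `P`, the context in `τ` of the past `X_{-∞}^{-1}` is almost surely finite. -/
def FiniteContextsAS {K : ℕ} (τ : Set (PastString K)) (P : Measure (ℤ → Fin K)) : Prop :=
  ∀ᵐ z ∂P, ∃ w : List (Fin K), Sum.inl w ∈ τ ∧ past1 z ∈ cyl (Sum.inl w)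

/-! ### Piecewise monotone maps of `[0,1]`

A map of the interval is given by a function `T : ℝ → ℝ`; only its values at the points of `[0,1]`
which are not subdivision points matter. -/

/-- `0 = η_0 < η_1 < ⋯ < η_K = 1`. -/
structure IsSubdivision {K : ℕ} (η : Fin (K + 1) → ℝ) : Prop where
  zero : η 0 = 0
  last : η (Fin.last K) = 1
  strictMono : StrictMono η

/-- The open interval of the subdivision with index `j`. -/
def piece {K : ℕ} (η : Fin (K + 1) → ℝ) (j : Fin K) : Set ℝ := Ioo (η j.castSucc) (η j.succ)

/-- Points of `[0,1]` whose orbit never meets the subdivision points, that is, the points which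
have a code. -/
def codable {K : ℕ} (η : Fin (K + 1) → ℝ) (T : ℝ → ℝ) : Set ℝ :=
  {ω | ω ∈ Icc (0 : ℝ) 1 ∧ ∀ k : ℕ, T^[k] ω ∉ range η}

/-- The points with a code which starts with `w`: the symbol at time `i` is the index `j` of the
interval that contains `T^i ω`. -/
def codeCyl {K : ℕ} (η : Fin (K + 1) → ℝ) (T : ℝ → ℝ) (w : List (Fin K)) : Set ℝ :=
  {ω | ω ∈ codable η T ∧ ∀ (i : ℕ) (hi : i < w.length), T^[i] ω ∈ piece η w[i]}

/-- Topological Markov expanding maps of the interval. -/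
structure IsMarkovExpanding {K : ℕ} (η : Fin (K + 1) → ℝ) (T : ℝ → ℝ) : Prop where
  subdivision : IsSubdivision η
  mapsTo : ∀ j, MapsTo T (piece η j) (Icc 0 1)
  monotone : ∀ j, MonotoneOn T (piece η j) ∨ AntitoneOn T (piece η j)
  extends_C2 : ∀ j, ∃ g : ℝ → ℝ,
    ContDiffOn ℝ 2 g (Icc (η j.castSucc) (η j.succ)) ∧ EqOn T g (piece η j)
  expanding : ∃ (m : ℕ) (c : ℝ), 0 < m ∧ 1 < c ∧ ∀ ω ∈ Icc (0 : ℝ) 1,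
    (∀ k < m, T^[k] ω ∉ range η) → DifferentiableAt ℝ T^[m] ω → c ≤ |deriv T^[m] ω|
  markov : ∀ i, ∃ S : Set (Fin K), closure (T '' piece η i) = ⋃ j ∈ S, closure (piece η j)

/-- The Lebesgue measure of `[0,1]`. -/
def leb : Measure ℝ := volume.restrict (Icc (0 : ℝ) 1)

/-- `∑_k ∑_{w ∈ τ, |w| = k} λ(C(w)) = 1`, where `λ(C(w))` is the Lebesgue measure of the set of
points with a code starting with `w`. -/
def FiniteContextsFull {K : ℕ} (η : Fin (K + 1) → ℝ) (T : ℝ → ℝ) (τ : Set (PastString K)) : Prop :=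
  ∑' w : {w : List (Fin K) // Sum.inl w ∈ τ}, leb (codeCyl η T w.1) = 1

/-- For every finite context `w` and every symbol `a`, the derivative of `T` is constant on the set
of points with a code starting with `a w`. -/
def DerivConstOnContexts {K : ℕ} (η : Fin (K + 1) → ℝ) (T : ℝ → ℝ) (τ : Set (PastString K)) :
    Prop :=
  ∀ w : List (Fin K), Sum.inl w ∈ τ → ∀ a : Fin K,
    ∀ ω ∈ codeCyl η T (a :: w), ∀ ω' ∈ codeCyl η T (a :: w), deriv T ω = deriv T ω'

/-! ### From a map to a chain -/

/-- `P` is the law of the chain obtained by coding with `T`, with time reversed. -/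
def IsChainLaw {K : ℕ} (η : Fin (K + 1) → ℝ) (T : ℝ → ℝ) (P : Measure (ℤ → Fin K)) : Prop :=
  ∀ (n : ℤ) (w : List (Fin K)),
    P {z | ∀ (i : ℕ) (hi : i < w.length), z (n - i) = w[i]} = leb (codeCyl η T w)

/-- `p(b|a)` is the limit of `1 / |T'(ω_n)|`, for any points `ω_n` whose code starts with
`b, a_{-1}, …, a_{-n}`.  If the past `a` is admissible, and `b` cannot be put in front of it (this
cannot happen for a full Markov map), then `p(b|a) = 0`. -/
def IsAssociatedFamily {K : ℕ} (η : Fin (K + 1) → ℝ) (T : ℝ → ℝ) (p : Fin K → Past K → ℝ) : Prop :=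
  ∀ a : Past K, (∀ n, (codeCyl η T (recent a n)).Nonempty) → ∀ b : Fin K,
    (∀ ω : ℕ → ℝ, (∀ n, ω n ∈ codeCyl η T (b :: recent a n)) →
      Tendsto (fun n => 1 / |deriv T (ω n)|) atTop (𝓝 (p b a))) ∧
    ((∃ n, codeCyl η T (b :: recent a n) = ∅) → p b a = 0)

/-! ### From a chain to a map -/

/-- The lexicographic order on pasts `x_{-∞}^{0}`, starting at position `0`. -/
def lexLE {K : ℕ} (x y : Past K) : Prop :=
  x = y ∨ ∃ m : ℕ, (∀ i < m, x i = y i) ∧ x m < y m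

/-- `h(x) = P(J(x))`, the probability of the pasts which are at most `x`. -/
def distr {K : ℕ} (P : Measure (ℤ → Fin K)) (x : Past K) : ℝ := P.real {z | lexLE (past0 z) x}

/-- The exceptional codes: from some position on all symbols are the largest one and the symbol
before is not, or from some position on all symbols are the smallest one and the symbol before
is not. -/
def exceptional (K : ℕ) : Set (Past K) :=
  {x | ∃ m : ℕ, ((x m : ℕ) + 1 < K ∧ ∀ n > m, (x n : ℕ) + 1 = K) ∨
    (0 < (x m : ℕ) ∧ ∀ n > m, (x n : ℕ) = 0)}

/-- The end points `η_0 = 0`, and `η_j = h(x)` where `x` has the `j`-th symbol at position `0` and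
the largest symbol elsewhere. -/
def chainSubdiv {K : ℕ} (P : Measure (ℤ → Fin K)) : Fin (K + 1) → ℝ :=
  Fin.cases 0 fun j => distr P (consPast j fun _ => ⟨K - 1, Nat.sub_lt (Fin.pos j) Nat.one_pos⟩)

/-- `T` is the map associated with the chain of law `P`: it is `h ∘ shift ∘ h⁻¹` off the images of
the exceptional codes, extended by continuity inside each interval of the subdivision. -/
structure IsAssociatedMap {K : ℕ} (P : Measure (ℤ → Fin K)) (T : ℝ → ℝ) : Prop where
  conj : ∀ x : Past K, x ∉ exceptional K → T (distr P x) = distr P (shiftPast x)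
  continuousOn : ∀ j, ContinuousOn T (piece (chainSubdiv P) j)

/-- `T` is affine on each of a family, indexed by `ι`, of disjoint open intervals which cover
`[0,1]` up to a Lebesgue null set. -/
def IsPiecewiseAffine (ι : Type) (T : ℝ → ℝ) : Prop :=
  ∃ u v : ι → ℝ, (∀ i, u i < v i ∧ Ioo (u i) (v i) ⊆ Icc 0 1) ∧
    Pairwise (fun i j => Disjoint (Ioo (u i) (v i)) (Ioo (u j) (v j))) ∧
    leb (⋃ i, Ioo (u i) (v i))ᶜ = 0 ∧
    ∀ i, ∃ α β : ℝ, ∀ ω ∈ Ioo (u i) (v i), T ω = α * ω + β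

end VLChain

end

/-!
A map and a chain determine each other through codes: the law of the past is the image of Lebesgue
measure under the coding, and the transition probability `p(b|x)` is the density with which the
branch of the map over the piece `b` charges the point with code `x`, that is `1 / |T'|` at the
point with code `b x`.

*From a map to a chain.* Expansion of an iterate and invariance of Lebesgue measure bound `|T'|`
away from zero, so `T` is injective on pieces, and the Markov property makes the image of a piece
contain every piece it meets (`IsMarkovExpanding.subset_image_or_disjoint`). The change of variables
formula on each branch turns invariance into the identity `∑ b, 1 / |T' (ω_b)| = 1` for almost every
`y`, summed over its preimages `ω_b` (`IsMarkovExpanding.ae_sum_branchWeight`). A nonempty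
cylinder has positive measure, hence contains a point `y` at which this holds. The weights at such
points of smaller and smaller cylinders converge, because the map expands distances and `T'` extends
continuously to closed pieces (`IsMarkovExpanding.exists_tendsto_deriv`). Stopping at the
prefix which is a context makes the limit constant on contexts, and property (V) says that the
stopped weights are still the inverse derivatives (`IsMarkovExpanding.exists_transitionFamily`). The law of
the chain is a limit point of the laws of reversed codes, by compactness of the space of probability
measures on `A^ℤ` (`IsMarkovExpanding.exists_isChainLaw`); its invariance is the change of variables
formula again.

*From a chain to a map.* Let `μ` be the law of the past and `h` its lexicographic distribution
function. Invariance says that `μ (a B) = ∫_B p(a|x) dμ(x)`, so prepending a symbol `a` changes an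
increment of `h` by a factor between `ε` and `1 - ε`
(`IsNonNullLaw.le_cdf_consPast_sub`, `IsNonNullLaw.cdf_consPast_sub_le`). The contraction makes `h`
continuous and onto `[0,1]` (`IsNonNullLaw.exists_cdf_eq`); the lower bound, after cancelling common
prefixes, makes it injective off the exceptional pasts (`IsNonNullLaw.eq_of_cdf_eq`). Hence
`h (a y) ↦ h y` is a well-defined, strictly increasing Lipschitz map on the piece `a`, and it is the
only continuous choice because the exceptional pasts are countable (`IsAssociatedMap.apply`). Where
`p(a|·)` is constant, on a context `w`, the increments of `h` along `a w` and along `w` are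
proportional, so the map is affine on the image of the cylinder of `a w`
(`IsAssociatedMap.affine`). Since only countably many points have no code, these images
have the measure of the cylinders of codes (`IsAssociatedMap.leb_codeCyl`).
-/

noncomputable section

namespace VLChain

variable {K : ℕ}

/-! ### Cylinders determine measures -/

/-- Finite measures on a product of copies of a finite alphabet which agree on the cylinders over an
exhausting sequence of finite windows are equal: such cylinders are nested or disjoint, hence form
a π-system. -/
theorem measure_ext_of_cylinders {ι : Type*} [Countable ι] {K : ℕ} {μ ν : Measure (ι → Fin K)}
    [IsFiniteMeasure μ] (s : ℕ → Finset ι) (hs : Monotone s) (hcov : ∀ i, ∃ n, i ∈ s n)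
    (huniv : μ univ = ν univ)
    (h : ∀ n (v : ι → Fin K), μ {z | ∀ i ∈ s n, z i = v i} = ν {z | ∀ i ∈ s n, z i = v i}) :
    μ = ν := by
  have hmeas : ∀ n (v : ι → Fin K), MeasurableSet {z : ι → Fin K | ∀ i ∈ s n, z i = v i} := by
    intro n v
    have : {z : ι → Fin K | ∀ i ∈ s n, z i = v i} = ⋂ i ∈ s n, (fun z => z i) ⁻¹' {v i} := by
      ext z; simp
    rw [this]
    exact Finset.measurableSet_biInter _ fun i _ =>
      measurable_pi_apply i (measurableSet_singleton _)
  refine ext_of_generate_finite {A | ∃ n, ∃ v : ι → Fin K, A = {z | ∀ i ∈ s n, z i = v i}}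
    ?_ ?_ ?_ huniv
  · apply le_antisymm
    · rw [MeasurableSpace.pi, iSup_le_iff]
      intro i
      obtain ⟨n, hn⟩ := hcov i
      rintro _ ⟨B, -, rfl⟩
      -- an event about one coordinate is the finite union of the window cylinders it meets
      have hfin : ((fun v : ι → Fin K => {z : ι → Fin K | ∀ i ∈ s n, z i = v i}) ''
          ((fun z : ι → Fin K => z i) ⁻¹' B)).Finite := by
        let g : (s n → Fin K) → Set (ι → Fin K) := fun u => {z | ∀ i : s n, z i = u i}
        refine (Set.finite_range g).subset ?_
        rintro _ ⟨v, -, rfl⟩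
        exact ⟨fun i => v i, by ext z; simp [g]⟩
      have heq : (fun z : ι → Fin K => z i) ⁻¹' B =
          ⋃₀ ((fun v : ι → Fin K => {z : ι → Fin K | ∀ i ∈ s n, z i = v i}) ''
          ((fun z : ι → Fin K => z i) ⁻¹' B)) := by
        ext z
        simp only [mem_preimage, sUnion_image, mem_iUnion, mem_ofPred_eq, exists_prop]
        constructor
        · intro hz; exact ⟨z, hz, fun _ _ => rfl⟩
        · rintro ⟨v, hv, hz⟩; rw [hz i hn]; exact hv
      rw [heq]
      refine MeasurableSet.sUnion hfin.countable ?_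
      rintro _ ⟨v, -, rfl⟩
      exact MeasurableSpace.measurableSet_generateFrom ⟨n, v, rfl⟩
    · refine MeasurableSpace.generateFrom_le ?_
      rintro _ ⟨n, v, rfl⟩
      exact hmeas n v
  · rintro _ ⟨n, v, rfl⟩ _ ⟨m, u, rfl⟩ ⟨z, hz1, hz2⟩
    refine ⟨max n m, z, ?_⟩
    ext y
    simp only [mem_inter_iff, mem_ofPred_eq] at *
    constructor
    · rintro ⟨h1, h2⟩ i hi
      rcases le_total n m with hnm | hnm
      · rw [max_eq_right hnm] at hi; rw [h2 i hi, hz2 i hi]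
      · rw [max_eq_left hnm] at hi; rw [h1 i hi, hz1 i hi]
    · intro hy
      exact ⟨fun i hi => by rw [hy i (hs (le_max_left _ _) hi), hz1 i hi],
        fun i hi => by rw [hy i (hs (le_max_right _ _) hi), hz2 i hi]⟩
  · rintro _ ⟨n, v, rfl⟩
    exact h n v

/-! ### Pasts and words -/


@[simp] theorem consPast_zero (a : Fin K) (x : Past K) : consPast a x 0 = a := rfl

@[simp] theorem consPast_succ (a : Fin K) (x : Past K) (n : ℕ) : consPast a x (n + 1) = x n := rfl

@[simp] theorem shiftPast_consPast (a : Fin K) (x : Past K) : shiftPast (consPast a x) = x := rfl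

@[simp] theorem consPast_shiftPast (x : Past K) : consPast (x 0) (shiftPast x) = x := by
  funext n; cases n <;> rfl

theorem measurable_consPast (a : Fin K) : Measurable (consPast a) := by
  refine measurable_pi_iff.2 fun n => ?_
  cases n with
  | zero => exact measurable_const
  | succ n => exact measurable_pi_apply n

theorem measurable_shiftPast : Measurable (shiftPast (K := K)) :=
  measurable_pi_iff.2 fun n => measurable_pi_apply (n + 1)

theorem continuous_shiftPast : Continuous (shiftPast (K := K)) :=
  continuous_pi fun n => continuous_apply (n + 1)

theorem measurable_past0 : Measurable (past0 (K := K)) :=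
  measurable_pi_iff.2 fun _ => measurable_pi_apply _

theorem measurable_past1 : Measurable (past1 (K := K)) :=
  measurable_pi_iff.2 fun _ => measurable_pi_apply _

theorem shiftPast_past0 (z : ℤ → Fin K) : shiftPast (past0 z) = past1 z := by
  funext n; simp only [shiftPast, past0, past1]; congr 1; push_cast; ring

theorem cyl_nil : cyl (Sum.inl ([] : List (Fin K))) = univ := by
  ext x; simp [cyl]

theorem mem_cyl_cons {a : Fin K} {w : List (Fin K)} {x : Past K} :
    x ∈ cyl (Sum.inl (a :: w)) ↔ x 0 = a ∧ shiftPast x ∈ cyl (Sum.inl w) := by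
  simp only [cyl, mem_ofPred_eq, List.length_cons, shiftPast]
  constructor
  · intro h
    exact ⟨h 0 (by omega), fun i hi => h (i + 1) (by omega)⟩
  · rintro ⟨h0, h⟩ i hi
    cases i with
    | zero => exact h0
    | succ i => exact h i (by omega)

theorem consPast_mem_cyl_cons {a b : Fin K} {w : List (Fin K)} {x : Past K} :
    consPast b x ∈ cyl (Sum.inl (a :: w)) ↔ b = a ∧ x ∈ cyl (Sum.inl w) := by
  simp [mem_cyl_cons]

theorem isClopen_cyl (w : List (Fin K)) : IsClopen (cyl (Sum.inl w)) := by
  induction w with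
  | nil => rw [cyl_nil]; exact isClopen_univ
  | cons a w ih =>
    have : cyl (Sum.inl (a :: w)) =
        (fun x : Past K => x 0) ⁻¹' {a} ∩ shiftPast ⁻¹' cyl (Sum.inl w) := by
      ext x; exact mem_cyl_cons
    rw [this]
    exact ((isClopen_discrete {a}).preimage (continuous_apply 0)).inter
      (ih.preimage continuous_shiftPast)

theorem measurableSet_cyl (w : List (Fin K)) : MeasurableSet (cyl (Sum.inl w)) :=
  (isClopen_cyl w).isClosed.measurableSet

theorem length_recent (x : Past K) (n : ℕ) : (recent x n).length = n := by simp [recent]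

theorem mem_cyl_recent {x y : Past K} {n : ℕ} :
    y ∈ cyl (Sum.inl (recent x n)) ↔ ∀ i < n, y i = x i := by
  simp [cyl, recent]

theorem recent_succ (x : Past K) (n : ℕ) : recent x (n + 1) = x 0 :: recent (shiftPast x) n := by
  simp [recent, List.ofFn_succ, shiftPast]

theorem mem_cyl_iff_recent {x : Past K} {w : List (Fin K)} :
    x ∈ cyl (Sum.inl w) ↔ recent x w.length = w := by
  constructor
  · intro h
    refine List.ext_getElem (length_recent _ _) fun i h1 h2 => ?_
    simpa [recent] using h i h2
  · intro h
    rw [← h, mem_cyl_recent]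
    exact fun _ _ => rfl

theorem recent_prefix (x : Past K) {m n : ℕ} (h : m ≤ n) : recent x m <+: recent x n := by
  have : recent x m = (recent x n).take m := by
    refine List.ext_getElem (by simp [recent, h]) fun i h1 h2 => ?_
    simp [recent]
  rw [this]
  exact List.take_prefix _ _

theorem eq_head_cons_of_mem_cyl {x : Past K} {w : List (Fin K)} (hw : 1 ≤ w.length)
    (h : x ∈ cyl (Sum.inl w)) : ∃ v, w = x 0 :: v := by
  cases w with
  | nil => simp at hw
  | cons a v => exact ⟨v, by rw [(mem_cyl_cons.1 h).1]⟩

/-- Finite measures on pasts which agree on the cylinders of finite words are equal. -/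
theorem measure_ext_of_cyl {μ ν : Measure (Past K)} [IsFiniteMeasure μ]
    (h : ∀ w : List (Fin K), μ (cyl (Sum.inl w)) = ν (cyl (Sum.inl w))) : μ = ν := by
  refine measure_ext_of_cylinders Finset.range Finset.range_mono (fun i => ⟨i + 1, by simp⟩) ?_ ?_
  · simpa [cyl_nil] using h []
  · intro n v
    have : {z : Past K | ∀ i ∈ Finset.range n, z i = v i} = cyl (Sum.inl (recent v n)) := by
      ext z; simp [mem_cyl_recent]
    rw [this, h]

/-! ### The lexicographic order on pasts -/

/-- The strict lexicographic order on pasts. -/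
def lexLT (x y : Past K) : Prop := ∃ m : ℕ, (∀ i < m, x i = y i) ∧ x m < y m

theorem lexLE_iff_toLex {x y : Past K} : lexLE x y ↔ toLex x ≤ toLex y := by
  refine Iff.trans ?_ (le_iff_eq_or_lt (a := toLex x) (b := toLex y)).symm
  rw [toLex_inj]
  rfl

theorem not_lexLT {x y : Past K} : ¬lexLT x y ↔ lexLE y x := by
  rw [lexLE_iff_toLex]
  exact not_lt (a := toLex x) (b := toLex y)

theorem not_lexLE {x y : Past K} : ¬lexLE x y ↔ lexLT y x := by
  rw [← not_lexLT, not_not]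

theorem lexLE_refl (x : Past K) : lexLE x x := Or.inl rfl

theorem lexLT.le {x y : Past K} (h : lexLT x y) : lexLE x y := Or.inr h

theorem lexLE.trans {x y z : Past K} (h : lexLE x y) (h' : lexLE y z) : lexLE x z := by
  rw [lexLE_iff_toLex] at *
  exact le_trans h h'

theorem lexLE_total (x y : Past K) : lexLE x y ∨ lexLE y x := by
  rw [lexLE_iff_toLex, lexLE_iff_toLex]
  exact le_total _ _

theorem lexLE.antisymm {x y : Past K} (h : lexLE x y) (h' : lexLE y x) : x = y := by
  rw [lexLE_iff_toLex] at *
  exact toLex_inj.1 (le_antisymm h h')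

theorem lexLE_iff_eq_or_lexLT {x y : Past K} : lexLE x y ↔ x = y ∨ lexLT x y := Iff.rfl

theorem consPast_lt_consPast {a b : Fin K} {x y : Past K} :
    lexLT (consPast a x) (consPast b y) ↔ a < b ∨ a = b ∧ lexLT x y := by
  simp only [lexLT]
  constructor
  · rintro ⟨m, hm, hlt⟩
    cases m with
    | zero => exact Or.inl hlt
    | succ m => exact Or.inr ⟨hm 0 (by omega), m, fun i hi => hm (i + 1) (by omega), hlt⟩
  · rintro (h | ⟨rfl, m, hm, hlt⟩)
    · exact ⟨0, by simp, h⟩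
    · refine ⟨m + 1, fun i hi => ?_, hlt⟩
      cases i with
      | zero => rfl
      | succ i => exact hm i (by omega)

theorem consPast_lt_consPast_same {a : Fin K} {x y : Past K} :
    lexLT (consPast a x) (consPast a y) ↔ lexLT x y := by
  simp [consPast_lt_consPast]

theorem consPast_le_consPast_same {a : Fin K} {x y : Past K} :
    lexLE (consPast a x) (consPast a y) ↔ lexLE x y := by
  rw [← not_lexLT, consPast_lt_consPast_same, not_lexLT]

/-- The lexicographic interval `(x, y]`. -/
def lexIoc (x y : Past K) : Set (Past K) := {z | lexLT x z ∧ lexLE z y}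

theorem measurableSet_lex_gt (x : Past K) : MeasurableSet {z : Past K | lexLT x z} := by
  have : {z : Past K | lexLT x z} =
      ⋃ m : ℕ, (⋂ i ∈ Finset.range m, (fun z : Past K => z i) ⁻¹' {x i}) ∩
        (fun z : Past K => z m) ⁻¹' {a | x m < a} := by
    ext z
    simp only [mem_ofPred_eq, lexLT, mem_iUnion, mem_inter_iff, mem_iInter,
      Finset.mem_range, mem_preimage, mem_singleton_iff]
    exact exists_congr fun m => and_congr_left fun _ => forall₂_congr fun i _ => eq_comm
  rw [this]
  refine MeasurableSet.iUnion fun m => (Finset.measurableSet_biInter _ fun i _ => ?_).inter ?_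
  · exact measurable_pi_apply i (measurableSet_singleton _)
  · exact measurable_pi_apply m (Set.toFinite _).measurableSet

theorem measurableSet_lex_le (x : Past K) : MeasurableSet {z : Past K | lexLE z x} := by
  have : {z : Past K | lexLE z x} = {z : Past K | lexLT x z}ᶜ := by
    ext z; exact not_lexLT.symm
  rw [this]
  exact (measurableSet_lex_gt x).compl

theorem measurableSet_lexIoc (x y : Past K) : MeasurableSet (lexIoc x y) :=
  (measurableSet_lex_gt x).inter (measurableSet_lex_le y)

theorem image_consPast_eq (a : Fin K) (B : Set (Past K)) :
    consPast a '' B = {x | x 0 = a} ∩ shiftPast ⁻¹' B := by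
  ext x
  constructor
  · rintro ⟨y, hy, rfl⟩; exact ⟨rfl, hy⟩
  · rintro ⟨h0, hx⟩
    refine ⟨shiftPast x, hx, ?_⟩
    rw [← (h0 : x 0 = a), consPast_shiftPast]

theorem measurableSet_apply_zero (a : Fin K) : MeasurableSet {x : Past K | x 0 = a} :=
  measurable_pi_apply (X := fun _ : ℕ => Fin K) 0 (measurableSet_singleton a)

theorem image_consPast_lexIoc (a : Fin K) (x y : Past K) :
    consPast a '' lexIoc x y = lexIoc (consPast a x) (consPast a y) := by
  ext z
  constructor
  · rintro ⟨u, ⟨h1, h2⟩, rfl⟩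
    exact ⟨consPast_lt_consPast_same.2 h1, consPast_le_consPast_same.2 h2⟩
  · rintro ⟨h1, h2⟩
    rw [← consPast_shiftPast z] at h1 h2 ⊢
    rw [consPast_lt_consPast] at h1
    rw [← not_lexLT, consPast_lt_consPast] at h2
    have h0 : z 0 = a := by
      rcases h1 with h1 | h1
      · exact absurd (Or.inl h1) h2
      · exact h1.1.symm
    subst h0
    refine ⟨shiftPast z, ⟨by simpa using h1, ?_⟩, rfl⟩
    simpa [not_lexLT] using h2

/-- The least past. -/
def botPast (hK : 0 < K) : Past K := fun _ => ⟨0, hK⟩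

/-- The greatest past. -/
def topPast (hK : 0 < K) : Past K := fun _ => ⟨K - 1, Nat.sub_lt hK Nat.one_pos⟩

theorem botPast_le (hK : 0 < K) (x : Past K) : lexLE (botPast hK) x := by
  rw [← not_lexLT, lexLT]
  rintro ⟨m, -, h⟩
  simp [botPast, Fin.lt_def] at h

theorem le_topPast (hK : 0 < K) (x : Past K) : lexLE x (topPast hK) := by
  rw [← not_lexLT, lexLT]
  rintro ⟨m, -, h⟩
  simp only [topPast, Fin.lt_def] at h
  have := (x m).2
  omega

theorem consPast_botPast (hK : 0 < K) : consPast ⟨0, hK⟩ (botPast hK) = botPast hK := by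
  funext n; cases n <;> rfl

theorem consPast_topPast (hK : 0 < K) :
    consPast ⟨K - 1, Nat.sub_lt hK Nat.one_pos⟩ (topPast hK) = topPast hK := by
  funext n; cases n <;> rfl

/-- The past obtained by writing the finite word `w` in front of the past `y`. -/
def app (w : List (Fin K)) (y : Past K) : Past K := w.foldr consPast y

@[simp] theorem app_nil (y : Past K) : app [] y = y := rfl

@[simp] theorem app_cons (a : Fin K) (w : List (Fin K)) (y : Past K) :
    app (a :: w) y = consPast a (app w y) := rfl

theorem app_append (w w' : List (Fin K)) (y : Past K) : app (w ++ w') y = app w (app w' y) := by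
  simp [app]

theorem app_mem_cyl (w : List (Fin K)) (y : Past K) : app w y ∈ cyl (Sum.inl w) := by
  induction w with
  | nil => simp [cyl_nil]
  | cons a w ih => simpa [consPast_mem_cyl_cons] using ih

theorem exists_eq_app {w : List (Fin K)} {x : Past K} (hx : x ∈ cyl (Sum.inl w)) :
    ∃ y, x = app w y := by
  induction w generalizing x with
  | nil => exact ⟨x, rfl⟩
  | cons a w ih =>
    obtain ⟨h0, h1⟩ := mem_cyl_cons.1 hx
    obtain ⟨y, hy⟩ := ih h1
    refine ⟨y, ?_⟩
    rw [app_cons, ← hy, ← h0, consPast_shiftPast]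

theorem app_le_app {w : List (Fin K)} {x y : Past K} :
    lexLE (app w x) (app w y) ↔ lexLE x y := by
  induction w with
  | nil => rfl
  | cons a w ih => rw [app_cons, app_cons, consPast_le_consPast_same, ih]

/-- The cylinder of a word is the lexicographic interval between its least and greatest element. -/
theorem mem_cyl_iff_lex (hK : 0 < K) {w : List (Fin K)} {x : Past K} :
    x ∈ cyl (Sum.inl w) ↔
      lexLE (app w (botPast hK)) x ∧ lexLE x (app w (topPast hK)) := by
  constructor
  · intro hx
    obtain ⟨y, rfl⟩ := exists_eq_app hx
    exact ⟨app_le_app.2 (botPast_le hK y), app_le_app.2 (le_topPast hK y)⟩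
  · induction w generalizing x with
    | nil => simp [cyl_nil]
    | cons a w ih =>
      rintro ⟨h1, h2⟩
      rw [← consPast_shiftPast x] at h1 h2 ⊢
      rw [app_cons, ← not_lexLT, consPast_lt_consPast] at h1 h2
      have h0 : x 0 = a := le_antisymm (not_lt.1 fun h => h2 (Or.inl h))
        (not_lt.1 fun h => h1 (Or.inl h))
      rw [consPast_mem_cyl_cons]
      refine ⟨h0, ih ⟨?_, ?_⟩⟩
      · exact not_lexLT.1 fun h => h1 (Or.inr ⟨h0, h⟩)
      · exact not_lexLT.1 fun h => h2 (Or.inr ⟨h0.symm, h⟩)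

theorem countable_exceptional : (exceptional K).Countable := by
  refine (Set.countable_range fun q : List (Fin K) × Fin K => app q.1 fun _ => q.2).mono ?_
  -- an exceptional past is constant from some position on
  have key : ∀ (m : ℕ) (x : Past K) (c : Fin K), (∀ n ≥ m, x n = c) →
      app (recent x m) (fun _ => c) = x := by
    intro m
    induction m with
    | zero => intro x c h; funext n; exact (h n (Nat.zero_le n)).symm
    | succ m ih =>
      intro x c h
      rw [recent_succ, app_cons, ih (shiftPast x) c fun n hn => h (n + 1) (by omega),
        consPast_shiftPast]
  rintro x ⟨m, ⟨-, h⟩ | ⟨-, h⟩⟩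
  · refine ⟨(recent x (m + 1), x (m + 1)), key _ _ _ fun n hn => Fin.ext ?_⟩
    have h1 := h n (by omega)
    have h2 := h (m + 1) (by omega)
    change (x n : ℕ) = x (m + 1)
    omega
  · refine ⟨(recent x (m + 1), x (m + 1)), key _ _ _ fun n hn => Fin.ext ?_⟩
    rw [h n (by omega), h (m + 1) (by omega)]

theorem exceptional_consPast {x : Past K} (a : Fin K) (hx : x ∈ exceptional K) :
    consPast a x ∈ exceptional K := by
  obtain ⟨m, h⟩ := hx
  refine ⟨m + 1, h.imp (fun h => ⟨h.1, ?_⟩) fun h => ⟨h.1, ?_⟩⟩ <;>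
  · intro n hn
    obtain ⟨n, rfl⟩ : ∃ k, n = k + 1 := ⟨n - 1, by omega⟩
    exact h.2 n (by omega)

/-! ### The distribution function of a non-null law on pasts -/

/-- `μ` is a law on pasts which is invariant for transition probabilities `p` that take values in
`[ε, 1]`, in the form `μ (a B) = ∫_B p(a|x) dμ(x)`. -/
structure IsNonNullLaw (μ : Measure (Past K)) (p : Fin K → Past K → ℝ) (ε : ℝ) : Prop where
  two_le : 2 ≤ K
  eps_pos : 0 < ε
  eps_le : ∀ a x, ε ≤ p a x
  family : IsTransitionFamily p
  prob : IsProbabilityMeasure μ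
  measureReal_image : ∀ a (B : Set (Past K)), MeasurableSet B →
    μ.real (consPast a '' B) = ∫ x in B, p a x ∂μ

/-- The distribution function of a law on pasts, for the lexicographic order. -/
def lexCdf (μ : Measure (Past K)) (x : Past K) : ℝ := μ.real {y | lexLE y x}

namespace IsNonNullLaw

variable {μ : Measure (Past K)} {p : Fin K → Past K → ℝ} {ε : ℝ}

theorem pos (H : IsNonNullLaw μ p ε) : 0 < K := lt_of_lt_of_le two_pos H.two_le

theorem le_one_sub (H : IsNonNullLaw μ p ε) (a : Fin K) (x : Past K) : p a x ≤ 1 - ε := by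
  have : Nontrivial (Fin K) := Fin.nontrivial_iff_two_le.2 H.two_le
  obtain ⟨b, hb⟩ := exists_ne a
  have h1 : p a x + p b x ≤ ∑ c, p c x := by
    rw [← Finset.sum_pair (f := fun c => p c x) hb.symm]
    exact Finset.sum_le_sum_of_subset_of_nonneg (Finset.subset_univ _)
      fun c _ _ => (H.family.mem_Icc c x).1
  rw [H.family.sum_eq_one] at h1
  linarith [H.eps_le b x]

theorem integrable (H : IsNonNullLaw μ p ε) (a : Fin K) : Integrable (p a) μ := by
  have := H.prob
  refine Integrable.of_bound (H.family.measurable a).aestronglyMeasurable 1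
    (ae_of_all _ fun x => ?_)
  rw [Real.norm_eq_abs, abs_le]
  have := H.family.mem_Icc a x
  exact ⟨by linarith [this.1], this.2⟩

theorem le_measureReal_image (H : IsNonNullLaw μ p ε) (a : Fin K) {B : Set (Past K)}
    (hB : MeasurableSet B) : ε * μ.real B ≤ μ.real (consPast a '' B) := by
  have := H.prob
  rw [H.measureReal_image a B hB]
  have := setIntegral_mono_on (μ := μ) (s := B) (f := fun _ => ε) (g := p a)
    (integrable_const _).integrableOn (H.integrable a).integrableOn hB fun x _ => H.eps_le a x
  simpa [mul_comm] using this

theorem measureReal_image_le (H : IsNonNullLaw μ p ε) (a : Fin K) {B : Set (Past K)}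
    (hB : MeasurableSet B) : μ.real (consPast a '' B) ≤ (1 - ε) * μ.real B := by
  have := H.prob
  rw [H.measureReal_image a B hB]
  have := setIntegral_mono_on (μ := μ) (s := B) (g := fun _ => 1 - ε) (f := p a)
    (H.integrable a).integrableOn (integrable_const _).integrableOn hB fun x _ => H.le_one_sub a x
  simpa [mul_comm] using this

theorem eps_lt_one (H : IsNonNullLaw μ p ε) : ε < 1 := by
  have h := H.le_one_sub ⟨0, H.pos⟩ (botPast H.pos)
  have := H.eps_le ⟨0, H.pos⟩ (botPast H.pos)
  linarith [H.eps_pos]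

theorem tendsto_pow (H : IsNonNullLaw μ p ε) : Tendsto (fun n : ℕ => (1 - ε) ^ n) atTop (𝓝 0) :=
  tendsto_pow_atTop_nhds_zero_of_lt_one (by linarith [H.eps_lt_one]) (by linarith [H.eps_pos])

/-- There are no atoms: each further symbol reduces probabilities at least by the factor
`1 - ε`. -/
theorem measureReal_singleton (H : IsNonNullLaw μ p ε) (x : Past K) : μ.real {x} = 0 := by
  have := H.prob
  have key : ∀ (n : ℕ) (x : Past K), μ.real {x} ≤ (1 - ε) ^ n := by
    intro n
    induction n with
    | zero => intro x; simp
    | succ n ih =>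
      intro x
      have h := H.measureReal_image_le (x 0) (B := {shiftPast x}) (measurableSet_singleton _)
      rw [image_singleton, consPast_shiftPast] at h
      rw [pow_succ']
      exact h.trans (mul_le_mul_of_nonneg_left (ih _) (by linarith [H.eps_lt_one]))
  exact le_antisymm (ge_of_tendsto' H.tendsto_pow fun n => key n x) measureReal_nonneg

theorem cdf_sub (H : IsNonNullLaw μ p ε) {x y : Past K} (h : lexLE x y) :
    lexCdf μ y - lexCdf μ x = μ.real (lexIoc x y) := by
  have := H.prob
  have h1 : {z | lexLE z y} = {z | lexLE z x} ∪ lexIoc x y := by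
    ext z
    simp only [mem_ofPred_eq, mem_union, lexIoc, ← not_lexLE (x := z)]
    constructor
    · intro hz
      by_cases hx : lexLE z x
      · exact Or.inl hx
      · exact Or.inr ⟨hx, hz⟩
    · rintro (hz | hz)
      · exact hz.trans h
      · exact hz.2
  have h2 : Disjoint {z | lexLE z x} (lexIoc x y) :=
    Set.disjoint_left.2 fun z hz hz' => not_lexLT.2 hz hz'.1
  rw [lexCdf, lexCdf, h1, measureReal_union h2 (measurableSet_lexIoc x y)]
  ring

theorem cdf_mono (H : IsNonNullLaw μ p ε) {x y : Past K} (h : lexLE x y) :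
    lexCdf μ x ≤ lexCdf μ y := by
  have := H.cdf_sub h
  have h0 : 0 ≤ μ.real (lexIoc x y) := measureReal_nonneg
  linarith

theorem lexLT_of_cdf_lt (H : IsNonNullLaw μ p ε) {x y : Past K} (h : lexCdf μ x < lexCdf μ y) :
    lexLT x y := not_lexLE.1 fun h' => h.not_ge (H.cdf_mono h')

theorem cdf_consPast_sub (H : IsNonNullLaw μ p ε) (a : Fin K) {x y : Past K} (h : lexLE x y) :
    lexCdf μ (consPast a y) - lexCdf μ (consPast a x) = ∫ z in lexIoc x y, p a z ∂μ := by
  rw [H.cdf_sub (consPast_le_consPast_same.2 h), ← image_consPast_lexIoc,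
    H.measureReal_image a _ (measurableSet_lexIoc x y)]

theorem le_cdf_consPast_sub (H : IsNonNullLaw μ p ε) (a : Fin K) {x y : Past K} (h : lexLE x y) :
    ε * (lexCdf μ y - lexCdf μ x) ≤ lexCdf μ (consPast a y) - lexCdf μ (consPast a x) := by
  rw [H.cdf_sub h, H.cdf_sub (consPast_le_consPast_same.2 h), ← image_consPast_lexIoc]
  exact H.le_measureReal_image a (measurableSet_lexIoc x y)

theorem cdf_consPast_sub_le (H : IsNonNullLaw μ p ε) (a : Fin K) {x y : Past K} (h : lexLE x y) :
    lexCdf μ (consPast a y) - lexCdf μ (consPast a x) ≤ (1 - ε) * (lexCdf μ y - lexCdf μ x) := by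
  rw [H.cdf_sub h, H.cdf_sub (consPast_le_consPast_same.2 h), ← image_consPast_lexIoc]
  exact H.measureReal_image_le a (measurableSet_lexIoc x y)

theorem abs_cdf_sub_le (H : IsNonNullLaw μ p ε) (a : Fin K) (x y : Past K) :
    ε * |lexCdf μ y - lexCdf μ x| ≤ |lexCdf μ (consPast a y) - lexCdf μ (consPast a x)| := by
  rcases lexLE_total x y with h | h
  · rw [abs_of_nonneg (sub_nonneg.2 (H.cdf_mono h)),
      abs_of_nonneg (sub_nonneg.2 (H.cdf_mono (consPast_le_consPast_same.2 h)))]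
    exact H.le_cdf_consPast_sub a h
  · rw [abs_sub_comm, abs_sub_comm (lexCdf μ (consPast a y)),
      abs_of_nonneg (sub_nonneg.2 (H.cdf_mono h)),
      abs_of_nonneg (sub_nonneg.2 (H.cdf_mono (consPast_le_consPast_same.2 h)))]
    exact H.le_cdf_consPast_sub a h

theorem abs_cdf_consPast_sub_le (H : IsNonNullLaw μ p ε) (a : Fin K) (x y : Past K) :
    |lexCdf μ (consPast a y) - lexCdf μ (consPast a x)| ≤
      (1 - ε) * |lexCdf μ y - lexCdf μ x| := by
  rcases lexLE_total x y with h | h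
  · rw [abs_of_nonneg (sub_nonneg.2 (H.cdf_mono h)),
      abs_of_nonneg (sub_nonneg.2 (H.cdf_mono (consPast_le_consPast_same.2 h)))]
    exact H.cdf_consPast_sub_le a h
  · rw [abs_sub_comm, abs_sub_comm (lexCdf μ y),
      abs_of_nonneg (sub_nonneg.2 (H.cdf_mono h)),
      abs_of_nonneg (sub_nonneg.2 (H.cdf_mono (consPast_le_consPast_same.2 h)))]
    exact H.cdf_consPast_sub_le a h

theorem cdf_consPast_eq_iff (H : IsNonNullLaw μ p ε) (a : Fin K) {x y : Past K} :
    lexCdf μ (consPast a x) = lexCdf μ (consPast a y) ↔ lexCdf μ x = lexCdf μ y := by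
  constructor <;> intro h
  · have := H.abs_cdf_sub_le a y x
    rw [h, sub_self, abs_zero] at this
    have h2 : |lexCdf μ x - lexCdf μ y| ≤ 0 := by
      by_contra hc
      have := mul_pos H.eps_pos (not_le.1 hc)
      linarith
    exact sub_eq_zero.1 (abs_nonpos_iff.1 h2)
  · have := H.abs_cdf_consPast_sub_le a y x
    rw [h, sub_self, abs_zero, mul_zero] at this
    exact sub_eq_zero.1 (abs_nonpos_iff.1 this)

theorem cdf_consPast_lt_iff (H : IsNonNullLaw μ p ε) (a : Fin K) {x y : Past K} :
    lexCdf μ (consPast a x) < lexCdf μ (consPast a y) ↔ lexCdf μ x < lexCdf μ y := by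
  have h := H.cdf_consPast_eq_iff a (x := x) (y := y)
  rcases lexLE_total x y with hxy | hxy
  · rw [lt_iff_le_and_ne, lt_iff_le_and_ne, Ne, Ne, h]
    simp [H.cdf_mono hxy, H.cdf_mono (consPast_le_consPast_same (a := a).2 hxy)]
  · simp [(H.cdf_mono hxy).not_gt, (H.cdf_mono (consPast_le_consPast_same (a := a).2 hxy)).not_gt]

theorem cdf_app_lt_iff (H : IsNonNullLaw μ p ε) (w : List (Fin K)) {x y : Past K} :
    lexCdf μ (app w x) < lexCdf μ (app w y) ↔ lexCdf μ x < lexCdf μ y := by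
  induction w with
  | nil => rfl
  | cons a w ih => rw [app_cons, app_cons, H.cdf_consPast_lt_iff, ih]

theorem cdf_app_eq (H : IsNonNullLaw μ p ε) (w : List (Fin K)) {x y : Past K}
    (h : lexCdf μ x = lexCdf μ y) : lexCdf μ (app w x) = lexCdf μ (app w y) := by
  induction w with
  | nil => exact h
  | cons a w ih => rwa [app_cons, app_cons, H.cdf_consPast_eq_iff]

theorem cdf_botPast (H : IsNonNullLaw μ p ε) : lexCdf μ (botPast H.pos) = 0 := by
  have : {y | lexLE y (botPast H.pos)} = {botPast H.pos} := by
    ext y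
    exact ⟨fun h => h.antisymm (botPast_le _ _), fun h => Or.inl h⟩
  rw [lexCdf, this, H.measureReal_singleton]

theorem cdf_topPast (H : IsNonNullLaw μ p ε) : lexCdf μ (topPast H.pos) = 1 := by
  have := H.prob
  have : {y | lexLE y (topPast H.pos)} = univ := eq_univ_of_forall fun y => le_topPast _ _
  rw [lexCdf, this, probReal_univ]

theorem cdf_mem_Icc (H : IsNonNullLaw μ p ε) (x : Past K) : lexCdf μ x ∈ Icc (0 : ℝ) 1 := by
  have := H.prob
  exact ⟨measureReal_nonneg, measureReal_le_one⟩

/-- The end of the branch at `j` and the start of the branch at `j + 1` have the same image, because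
nothing but one atomless past lies between them. -/
theorem cdf_adjacent (H : IsNonNullLaw μ p ε) {j k : Fin K} (hjk : (k : ℕ) = j + 1) :
    lexCdf μ (consPast k (botPast H.pos)) = lexCdf μ (consPast j (topPast H.pos)) := by
  have hlt : lexLT (consPast j (topPast H.pos)) (consPast k (botPast H.pos)) :=
    consPast_lt_consPast.2 (Or.inl (Fin.lt_def.2 (by omega)))
  have hs : lexIoc (consPast j (topPast H.pos)) (consPast k (botPast H.pos)) =
      {consPast k (botPast H.pos)} := by
    ext z
    constructor
    · rintro ⟨h1, h2⟩
      refine h2.antisymm ?_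
      rw [← consPast_shiftPast z, consPast_lt_consPast] at h1
      rw [← consPast_shiftPast z, ← not_lexLT, consPast_lt_consPast]
      rintro (h | ⟨-, h⟩)
      · rcases h1 with h1 | ⟨-, h1⟩
        · rw [Fin.lt_def] at h h1; omega
        · exact not_lexLT.2 (le_topPast _ _) h1
      · exact not_lexLT.2 (botPast_le _ _) h
    · rintro rfl
      exact ⟨hlt, lexLE_refl _⟩
  have := H.cdf_sub hlt.le
  rw [hs, H.measureReal_singleton] at this
  linarith

theorem abs_cdf_sub_le_pow (H : IsNonNullLaw μ p ε) (n : ℕ) {x y : Past K}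
    (h : ∀ i < n, x i = y i) : |lexCdf μ x - lexCdf μ y| ≤ (1 - ε) ^ n := by
  induction n generalizing x y with
  | zero =>
    have h1 := H.cdf_mem_Icc x
    have h2 := H.cdf_mem_Icc y
    rw [pow_zero, abs_le]
    exact ⟨by linarith [h1.1, h2.2], by linarith [h1.2, h2.1]⟩
  | succ n ih =>
    have h0 := h 0 (by omega)
    rw [← consPast_shiftPast x, ← consPast_shiftPast y, ← h0, pow_succ']
    refine (H.abs_cdf_consPast_sub_le _ _ _).trans
      (mul_le_mul_of_nonneg_left (ih fun i hi => h (i + 1) (by omega)) ?_)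
    linarith [H.eps_lt_one]

theorem continuous_cdf (H : IsNonNullLaw μ p ε) : Continuous (lexCdf μ) := by
  rw [continuous_iff_continuousAt]
  intro x
  rw [ContinuousAt, Metric.tendsto_nhds]
  intro δ hδ
  obtain ⟨n, hn⟩ := (H.tendsto_pow.eventually (gt_mem_nhds hδ)).exists
  filter_upwards [(isClopen_cyl (recent x n)).isOpen.mem_nhds
    (mem_cyl_recent.2 fun _ _ => rfl)] with y hy
  rw [Real.dist_eq]
  exact (H.abs_cdf_sub_le_pow n (mem_cyl_recent.1 hy)).trans_lt hn

/-- The images of the cylinders of words of length `n` cover `[0,1]`, since consecutive ones have a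
common end point. -/
theorem exists_word (H : IsNonNullLaw μ p ε) {t : ℝ} (ht : t ∈ Icc (0 : ℝ) 1) (n : ℕ) :
    ∃ w : List (Fin K), w.length = n ∧
      t ∈ Icc (lexCdf μ (app w (botPast H.pos))) (lexCdf μ (app w (topPast H.pos))) := by
  induction n with
  | zero => exact ⟨[], rfl, by simpa [H.cdf_botPast, H.cdf_topPast] using ht⟩
  | succ n ih =>
    obtain ⟨w, hw, h1, h2⟩ := ih
    -- the first symbol whose branch ends beyond `t`
    let S : Finset (Fin K) :=
      Finset.univ.filter fun j => t ≤ lexCdf μ (app w (consPast j (topPast H.pos)))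
    have hS : S.Nonempty := by
      refine ⟨⟨K - 1, Nat.sub_lt H.pos Nat.one_pos⟩, ?_⟩
      rw [Finset.mem_filter, consPast_topPast]
      exact ⟨Finset.mem_univ _, h2⟩
    set j := S.min' hS with hj
    have hjS : j ∈ S := Finset.min'_mem _ _
    refine ⟨w ++ [j], by simp [hw], ?_, ?_⟩
    · rw [app_append, app_cons, app_nil]
      by_cases h0 : (j : ℕ) = 0
      · have : j = ⟨0, H.pos⟩ := Fin.ext h0
        rw [this, consPast_botPast]
        exact h1
      · have hjK := j.2
        let i : Fin K := ⟨j - 1, by omega⟩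
        have hi : i ∉ S := fun hi => by
          have := Fin.le_def.1 (Finset.min'_le _ _ hi)
          simp only [← hj, i] at this
          omega
        have hlt : lexCdf μ (app w (consPast i (topPast H.pos))) < t := by
          simpa [S] using hi
        rw [H.cdf_app_eq w (H.cdf_adjacent (j := i) (k := j) (by simp only [i]; omega))]
        exact hlt.le
    · rw [app_append, app_cons, app_nil]
      exact (Finset.mem_filter.1 hjS).2

/-- The distribution function is onto `[0,1]`: its range is compact, and dense because the images of
long cylinders are short and cover `[0,1]`. -/
theorem exists_cdf_eq (H : IsNonNullLaw μ p ε) {t : ℝ} (ht : t ∈ Icc (0 : ℝ) 1) :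
    ∃ x, lexCdf μ x = t := by
  have hclosed : IsClosed (range (lexCdf μ)) := (isCompact_range H.continuous_cdf).isClosed
  change t ∈ range (lexCdf μ)
  rw [← hclosed.closure_eq, Metric.mem_closure_iff]
  intro δ hδ
  obtain ⟨n, hn⟩ := (H.tendsto_pow.eventually (gt_mem_nhds hδ)).exists
  obtain ⟨w, hw, h1, h2⟩ := H.exists_word ht n
  refine ⟨_, ⟨app w (topPast H.pos), rfl⟩, lt_of_le_of_lt ?_ hn⟩
  have := H.abs_cdf_sub_le_pow n (x := app w (topPast H.pos)) (y := app w (botPast H.pos))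
    fun i hi => by
      rw [← hw] at hi
      rw [app_mem_cyl w (topPast H.pos) i hi, app_mem_cyl w (botPast H.pos) i hi]
  rw [dist_comm, Real.dist_eq, abs_of_nonneg (by linarith)]
  rw [abs_of_nonneg (by linarith)] at this
  linarith

theorem cdf_consPast_mem_Icc (H : IsNonNullLaw μ p ε) (a : Fin K) (x : Past K) :
    lexCdf μ (consPast a x) ∈ Icc (lexCdf μ (consPast a (botPast H.pos)))
      (lexCdf μ (consPast a (topPast H.pos))) :=
  ⟨H.cdf_mono (consPast_le_consPast_same.2 (botPast_le _ _)),
    H.cdf_mono (consPast_le_consPast_same.2 (le_topPast _ _))⟩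

theorem cdf_bot_lt_top (H : IsNonNullLaw μ p ε) :
    lexCdf μ (botPast H.pos) < lexCdf μ (topPast H.pos) := by
  rw [H.cdf_botPast, H.cdf_topPast]; exact one_pos

theorem cdf_consPast_le_of_lt (H : IsNonNullLaw μ p ε) {a b : Fin K} (h : a < b) (x y : Past K) :
    lexCdf μ (consPast a x) ≤ lexCdf μ (consPast b y) :=
  H.cdf_mono (consPast_lt_consPast.2 (Or.inl h)).le

theorem eq_topPast_of_cdf_eq_one (H : IsNonNullLaw μ p ε) {x : Past K} (h : lexCdf μ x = 1) :
    x = topPast H.pos := by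
  have head : ∀ x : Past K, lexCdf μ x = 1 → x 0 = ⟨K - 1, Nat.sub_lt H.pos Nat.one_pos⟩ := by
    intro x h
    by_contra hne
    have hlt : x 0 < ⟨K - 1, Nat.sub_lt H.pos Nat.one_pos⟩ := by
      have h2 := (x 0).2
      have h3 : (x 0 : ℕ) ≠ K - 1 := fun h => hne (Fin.ext h)
      exact Fin.lt_def.2 (by change (x 0 : ℕ) < K - 1; omega)
    have h1 := H.cdf_consPast_le_of_lt hlt (shiftPast x) (botPast H.pos)
    have h2 := (H.cdf_consPast_lt_iff ⟨K - 1, Nat.sub_lt H.pos Nat.one_pos⟩).2 H.cdf_bot_lt_top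
    rw [consPast_topPast, H.cdf_topPast] at h2
    rw [consPast_shiftPast, h] at h1
    linarith
  funext n
  induction n generalizing x with
  | zero => exact head x h
  | succ n ih =>
    have h0 := head x h
    rw [← consPast_shiftPast x, h0, ← H.cdf_topPast, ← consPast_topPast H.pos,
      H.cdf_consPast_eq_iff, H.cdf_topPast] at h
    exact ih h

theorem eq_botPast_of_cdf_eq_zero (H : IsNonNullLaw μ p ε) {x : Past K} (h : lexCdf μ x = 0) :
    x = botPast H.pos := by
  have head : ∀ x : Past K, lexCdf μ x = 0 → x 0 = ⟨0, H.pos⟩ := by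
    intro x h
    by_contra hne
    have hlt : ⟨0, H.pos⟩ < x 0 :=
      Fin.lt_def.2 (Nat.pos_of_ne_zero fun h => hne (Fin.ext h))
    have h1 := H.cdf_consPast_le_of_lt hlt (topPast H.pos) (shiftPast x)
    have h2 := (H.cdf_consPast_lt_iff ⟨0, H.pos⟩).2 H.cdf_bot_lt_top
    rw [consPast_botPast, H.cdf_botPast] at h2
    rw [consPast_shiftPast, h] at h1
    linarith
  funext n
  induction n generalizing x with
  | zero => exact head x h
  | succ n ih =>
    have h0 := head x h
    rw [← consPast_shiftPast x, h0, ← H.cdf_botPast, ← consPast_botPast H.pos,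
      H.cdf_consPast_eq_iff, H.cdf_botPast] at h
    exact ih h

/-- The distribution function identifies two distinct pasts only if both are exceptional: after
removal of the common prefix, one continues with the largest symbol forever and the other with the
smallest one. -/
theorem exceptional_of_cdf_eq (H : IsNonNullLaw μ p ε) {x y : Past K} (hlt : lexLT x y)
    (h : lexCdf μ x = lexCdf μ y) : x ∈ exceptional K ∧ y ∈ exceptional K := by
  obtain ⟨m, hm, hxy⟩ := hlt
  induction m generalizing x y with
  | zero =>
    have h1 := (H.cdf_consPast_mem_Icc (x 0) (shiftPast x)).2
    have h2 := (H.cdf_consPast_mem_Icc (y 0) (shiftPast y)).1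
    have h3 := H.cdf_consPast_le_of_lt hxy (topPast H.pos) (botPast H.pos)
    rw [consPast_shiftPast] at h1 h2
    have hx : lexCdf μ (consPast (x 0) (shiftPast x)) =
        lexCdf μ (consPast (x 0) (topPast H.pos)) := by rw [consPast_shiftPast]; linarith
    have hy : lexCdf μ (consPast (y 0) (shiftPast y)) =
        lexCdf μ (consPast (y 0) (botPast H.pos)) := by rw [consPast_shiftPast]; linarith
    rw [H.cdf_consPast_eq_iff, H.cdf_topPast] at hx
    rw [H.cdf_consPast_eq_iff, H.cdf_botPast] at hy
    have hx' := H.eq_topPast_of_cdf_eq_one hx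
    have hy' := H.eq_botPast_of_cdf_eq_zero hy
    have hK := H.pos
    rw [Fin.lt_def] at hxy
    refine ⟨⟨0, Or.inl ⟨by have := (y 0).2; omega, fun n hn => ?_⟩⟩,
      ⟨0, Or.inr ⟨by omega, fun n hn => ?_⟩⟩⟩ <;>
    obtain ⟨k, rfl⟩ : ∃ k, n = k + 1 := ⟨n - 1, by omega⟩
    · have := congrArg Fin.val (congrFun hx' k)
      simp only [shiftPast, topPast] at this
      omega
    · exact congrArg Fin.val (congrFun hy' k)
  | succ m ih =>
    have h0 := hm 0 (by omega)
    rw [← consPast_shiftPast x, ← consPast_shiftPast y, ← h0, H.cdf_consPast_eq_iff] at h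
    obtain ⟨hx, hy⟩ := ih h (fun i hi => hm (i + 1) (by omega)) hxy
    rw [← consPast_shiftPast x, ← consPast_shiftPast y]
    exact ⟨exceptional_consPast _ hx, exceptional_consPast _ hy⟩

theorem eq_of_cdf_eq (H : IsNonNullLaw μ p ε) {x y : Past K} (hx : x ∉ exceptional K)
    (h : lexCdf μ x = lexCdf μ y) : x = y := by
  by_contra hne
  by_cases hle : lexLE x y
  · exact hx (H.exceptional_of_cdf_eq (hle.resolve_left hne) h).1
  · exact hx (H.exceptional_of_cdf_eq (not_lexLE.1 hle) h.symm).2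

end IsNonNullLaw

/-! ### The interval map of a non-null chain -/

theorem distr_eq_lexCdf (P : Measure (ℤ → Fin K)) : distr P = lexCdf (P.map past0) := by
  funext x
  have h : MeasurableSet {y | lexLE y x} := measurableSet_lex_le x
  rw [distr, lexCdf, map_measureReal_apply measurable_past0 h]
  rfl

theorem Stationary.map_past1 {P : Measure (ℤ → Fin K)} (h : Stationary P) :
    P.map past1 = P.map past0 := by
  have h1 : past1 = past0 ∘ fun (z : ℤ → Fin K) (i : ℤ) => z (i - 1) := rfl
  rw [h1, ← Measure.map_map measurable_past0 h.measurable, h.map_eq]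

theorem indicator_consPast_cyl (a b : Fin K) (w : List (Fin K)) (x : Past K) :
    (cyl (Sum.inl (a :: w))).indicator (fun _ => (1 : ℝ)) (consPast b x) =
      if b = a then (cyl (Sum.inl w)).indicator (fun _ => (1 : ℝ)) x else 0 := by
  classical
  simp only [indicator_apply, consPast_mem_cyl_cons]
  by_cases h : b = a <;> simp [h]

/-- A stationary non-null chain induces a non-null law on pasts: the invariance, tested on
indicators of cylinders, which are continuous, extends to all measurable sets. -/
theorem isNonNullLaw {P : Measure (ℤ → Fin K)} {p : Fin K → Past K → ℝ} {ε : ℝ} (hK : 2 ≤ K)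
    (hp : IsTransitionFamily p) (hε : 0 < ε) (hle : ∀ a x, ε ≤ p a x) (hP : IsProbabilityMeasure P)
    (hs : Stationary P) (hinv : InvariantFor p P) : IsNonNullLaw (P.map past0) p ε := by
  have hμ : IsProbabilityMeasure (P.map past0) :=
    Measure.isProbabilityMeasure_map measurable_past0.aemeasurable
  refine ⟨hK, hε, hle, hp, hμ, fun a B hB => ?_⟩
  set μ := P.map past0 with hμdef
  have hint : Integrable (p a) μ := by
    refine Integrable.of_bound (hp.measurable a).aestronglyMeasurable 1 (ae_of_all _ fun x => ?_)
    rw [Real.norm_eq_abs, abs_le]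
    have := hp.mem_Icc a x
    exact ⟨by linarith [this.1], this.2⟩
  have hnn : ∀ x, 0 ≤ p a x := fun x => (hp.mem_Icc a x).1
  -- both sides of the claim are values at `B` of finite measures
  let ν₁ : Measure (Past K) := (μ.restrict {x | x 0 = a}).map shiftPast
  let ν₂ : Measure (Past K) := μ.withDensity fun x => ENNReal.ofReal (p a x)
  have hν₁ : ∀ C, MeasurableSet C → ν₁ C = μ (consPast a '' C) := by
    intro C hC
    rw [Measure.map_apply measurable_shiftPast hC,
      Measure.restrict_apply (measurable_shiftPast hC), image_consPast_eq, inter_comm]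
  have hν₂ : ∀ C, MeasurableSet C → ν₂ C = ENNReal.ofReal (∫ x in C, p a x ∂μ) := by
    intro C hC
    rw [withDensity_apply _ hC, ofReal_integral_eq_lintegral_ofReal hint.integrableOn
      (ae_of_all _ hnn)]
  have heq : ν₁ = ν₂ := by
    refine measure_ext_of_cyl fun w => ?_
    have hmeas := measurableSet_cyl w
    rw [hν₁ _ hmeas, hν₂ _ hmeas]
    have himg : consPast a '' cyl (Sum.inl w) = cyl (Sum.inl (a :: w)) := by
      rw [image_consPast_eq]; ext x; exact mem_cyl_cons.symm
    have hf : Continuous ((cyl (Sum.inl (a :: w))).indicator fun _ => (1 : ℝ)) :=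
      (continuous_const).indicator (by simp [(isClopen_cyl (a :: w)).frontier_eq])
    have h := hinv _ hf
    have h1 : ∫ z, (cyl (Sum.inl (a :: w))).indicator (fun _ => (1 : ℝ)) (past0 z) ∂P =
        μ.real (cyl (Sum.inl (a :: w))) := by
      rw [hμdef, ← integral_map measurable_past0.aemeasurable hf.aestronglyMeasurable,
        integral_indicator_const _ (measurableSet_cyl _)]
      simp
    have h2 : ∀ x : Past K, ∑ b, p b x *
        (cyl (Sum.inl (a :: w))).indicator (fun _ => (1 : ℝ)) (consPast b x) =
        (cyl (Sum.inl w)).indicator (p a) x := by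
      intro x
      classical
      simp only [indicator_consPast_cyl, mul_ite, mul_zero, Finset.sum_ite_eq', Finset.mem_univ,
        if_true]
      by_cases hx : x ∈ cyl (Sum.inl w) <;> simp [hx]
    have h3 : ∫ z, ∑ b, p b (past1 z) *
        (cyl (Sum.inl (a :: w))).indicator (fun _ => (1 : ℝ)) (consPast b (past1 z)) ∂P =
        ∫ x in cyl (Sum.inl w), p a x ∂μ := by
      simp only [h2]
      rw [hμdef, ← hs.map_past1, ← integral_indicator hmeas,
        integral_map measurable_past1.aemeasurable
        ((hp.measurable a).indicator hmeas).aestronglyMeasurable]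
    rw [himg, ← h3, ← h, h1, measureReal_def, ENNReal.ofReal_toReal (measure_ne_top _ _)]
  have := hν₁ B hB
  rw [heq, hν₂ B hB] at this
  rw [measureReal_def, ← this, ENNReal.toReal_ofReal (integral_nonneg hnn)]

section

variable {P : Measure (ℤ → Fin K)} {p : Fin K → Past K → ℝ} {ε : ℝ}

theorem chainSubdiv_succ (H : IsNonNullLaw (P.map past0) p ε) (j : Fin K) :
    chainSubdiv P j.succ = lexCdf (P.map past0) (consPast j (topPast H.pos)) := by
  rw [← distr_eq_lexCdf]; rfl

theorem chainSubdiv_castSucc (H : IsNonNullLaw (P.map past0) p ε) (j : Fin K) :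
    chainSubdiv P j.castSucc = lexCdf (P.map past0) (consPast j (botPast H.pos)) := by
  by_cases h : (j : ℕ) = 0
  · have h1 : j = ⟨0, H.pos⟩ := Fin.ext h
    rw [h1, consPast_botPast, H.cdf_botPast]
    rfl
  · have hj := j.2
    have h1 : j.castSucc = Fin.succ ⟨j - 1, by omega⟩ :=
      Fin.ext (by simp only [Fin.val_castSucc, Fin.val_succ]; omega)
    rw [h1, chainSubdiv_succ H,
      H.cdf_adjacent (j := ⟨j - 1, by omega⟩) (k := j) (by simp only; omega)]

theorem isSubdivision_chainSubdiv (H : IsNonNullLaw (P.map past0) p ε) :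
    IsSubdivision (chainSubdiv P) := by
  refine ⟨rfl, ?_, ?_⟩
  · have hK := H.pos
    have h1 : Fin.last K = Fin.succ ⟨K - 1, Nat.sub_lt H.pos Nat.one_pos⟩ :=
      Fin.ext (by simp only [Fin.val_last, Fin.val_succ]; omega)
    rw [h1, chainSubdiv_succ H, consPast_topPast, H.cdf_topPast]
  · rw [Fin.strictMono_iff_lt_succ]
    intro j
    rw [chainSubdiv_succ H, chainSubdiv_castSucc H, H.cdf_consPast_lt_iff]
    exact H.cdf_bot_lt_top

theorem mem_piece_chainSubdiv (H : IsNonNullLaw (P.map past0) p ε) {j : Fin K} {t : ℝ} :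
    t ∈ piece (chainSubdiv P) j ↔ lexCdf (P.map past0) (consPast j (botPast H.pos)) < t ∧
      t < lexCdf (P.map past0) (consPast j (topPast H.pos)) := by
  rw [piece, chainSubdiv_succ H, chainSubdiv_castSucc H, mem_Ioo]

theorem head_eq_of_mem_piece (H : IsNonNullLaw (P.map past0) p ε) {j : Fin K} {x : Past K}
    (h : lexCdf (P.map past0) x ∈ piece (chainSubdiv P) j) : x 0 = j := by
  rw [mem_piece_chainSubdiv H, ← consPast_shiftPast x] at h
  refine le_antisymm (not_lt.1 fun hlt => ?_) (not_lt.1 fun hlt => ?_)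
  · exact h.2.not_ge (H.cdf_consPast_le_of_lt hlt _ _)
  · exact h.1.not_ge (H.cdf_consPast_le_of_lt hlt _ _)

theorem exists_consPast_of_mem_piece (H : IsNonNullLaw (P.map past0) p ε) {j : Fin K} {t : ℝ}
    (h : t ∈ piece (chainSubdiv P) j) : ∃ y, lexCdf (P.map past0) (consPast j y) = t := by
  have h' := (mem_piece_chainSubdiv H).1 h
  obtain ⟨x, rfl⟩ := H.exists_cdf_eq
    ⟨(H.cdf_mem_Icc _).1.trans h'.1.le, h'.2.le.trans (H.cdf_mem_Icc _).2⟩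
  refine ⟨shiftPast x, ?_⟩
  rw [← head_eq_of_mem_piece H h, consPast_shiftPast]

theorem consPast_mem_piece (H : IsNonNullLaw (P.map past0) p ε) {j : Fin K} {y : Past K} :
    lexCdf (P.map past0) (consPast j y) ∈ piece (chainSubdiv P) j ↔
      lexCdf (P.map past0) y ∈ Ioo (0 : ℝ) 1 := by
  rw [mem_piece_chainSubdiv H, H.cdf_consPast_lt_iff, H.cdf_consPast_lt_iff, H.cdf_botPast,
    H.cdf_topPast, mem_Ioo]

/-- A map defined on each piece by `T (h (j y)) = h y` is continuous there: prepending a symbol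
shrinks distances by no more than the factor `ε`. -/
theorem continuousOn_piece (H : IsNonNullLaw (P.map past0) p ε) {T : ℝ → ℝ} {j : Fin K}
    (hT : ∀ y, lexCdf (P.map past0) (consPast j y) ∈ piece (chainSubdiv P) j →
      T (lexCdf (P.map past0) (consPast j y)) = lexCdf (P.map past0) y) :
    ContinuousOn T (piece (chainSubdiv P) j) := by
  have : LipschitzOnWith (Real.toNNReal ε⁻¹) T (piece (chainSubdiv P) j) := by
    refine LipschitzOnWith.of_dist_le_mul fun s hs t ht => ?_
    obtain ⟨x, rfl⟩ := exists_consPast_of_mem_piece H hs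
    obtain ⟨y, rfl⟩ := exists_consPast_of_mem_piece H ht
    rw [hT x hs, hT y ht, Real.dist_eq, Real.dist_eq,
      Real.coe_toNNReal _ (inv_nonneg.2 H.eps_pos.le), ← div_eq_inv_mul, le_div_iff₀ H.eps_pos,
      mul_comm]
    exact H.abs_cdf_sub_le j y x
  exact this.continuousOn

theorem exists_isAssociatedMap (H : IsNonNullLaw (P.map past0) p ε) :
    ∃ T : ℝ → ℝ, IsAssociatedMap P T ∧ ∀ (j : Fin K) (y : Past K),
      lexCdf (P.map past0) (consPast j y) ∈ piece (chainSubdiv P) j →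
      T (lexCdf (P.map past0) (consPast j y)) = lexCdf (P.map past0) y := by
  classical
  have hex : ∀ t : ℝ, ∃ x : Past K, t ∈ Icc (0 : ℝ) 1 → lexCdf (P.map past0) x = t := by
    intro t
    by_cases ht : t ∈ Icc (0 : ℝ) 1
    · obtain ⟨x, hx⟩ := H.exists_cdf_eq ht
      exact ⟨x, fun _ => hx⟩
    · exact ⟨botPast H.pos, fun h => absurd h ht⟩
  choose sec hsec using hex
  have hT : ∀ (j : Fin K) (y : Past K),
      lexCdf (P.map past0) (consPast j y) ∈ piece (chainSubdiv P) j →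
      lexCdf (P.map past0) (shiftPast (sec (lexCdf (P.map past0) (consPast j y)))) =
        lexCdf (P.map past0) y := by
    intro j y hy
    have h1 := hsec _ (H.cdf_mem_Icc (consPast j y))
    have h2 : sec (lexCdf (P.map past0) (consPast j y)) 0 = j :=
      head_eq_of_mem_piece H (by rwa [h1])
    generalize sec (lexCdf (P.map past0) (consPast j y)) = x at h1 h2 ⊢
    rw [← H.cdf_consPast_eq_iff j, ← h1, ← h2, consPast_shiftPast]
  refine ⟨fun t => lexCdf (P.map past0) (shiftPast (sec t)), ⟨fun x hx => ?_, fun j => ?_⟩, hT⟩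
  · rw [distr_eq_lexCdf]
    have h1 := hsec _ (H.cdf_mem_Icc x)
    rw [← H.eq_of_cdf_eq hx h1.symm]
  · exact continuousOn_piece H (hT j)

/-- The values inside the pieces are determined: they are prescribed off a countable set, whose
complement is dense, and extended by continuity. -/
theorem IsAssociatedMap.eqOn_piece {T T' : ℝ → ℝ} (H : IsNonNullLaw (P.map past0) p ε)
    (hT : IsAssociatedMap P T) (hT' : IsAssociatedMap P T') (j : Fin K) :
    EqOn T T' (piece (chainSubdiv P) j) := by
  intro t ht
  have hopen : piece (chainSubdiv P) j ∈ 𝓝 t := isOpen_Ioo.mem_nhds ht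
  have hdense : Dense (distr P '' exceptional K)ᶜ :=
    (countable_exceptional.image _).dense_compl ℝ
  refine tendsto_nhds_unique_of_frequently_eq ((hT.continuousOn j).continuousAt hopen)
    ((hT'.continuousOn j).continuousAt hopen) ?_
  refine ((mem_closure_iff_frequently.1 (hdense t)).and_eventually hopen).mono ?_
  rintro s ⟨hs, hsj⟩
  obtain ⟨y, hy⟩ := exists_consPast_of_mem_piece H hsj
  rw [← distr_eq_lexCdf] at hy
  have hne : consPast j y ∉ exceptional K := fun h => hs ⟨_, h, hy⟩
  rw [← hy, hT.conj _ hne, hT'.conj _ hne]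

theorem IsAssociatedMap.apply {T : ℝ → ℝ} (H : IsNonNullLaw (P.map past0) p ε)
    (hT : IsAssociatedMap P T) {j : Fin K} {y : Past K}
    (h : lexCdf (P.map past0) (consPast j y) ∈ piece (chainSubdiv P) j) :
    T (lexCdf (P.map past0) (consPast j y)) = lexCdf (P.map past0) y := by
  obtain ⟨T', hT', hf⟩ := exists_isAssociatedMap H
  rw [hT.eqOn_piece H hT' j h, hf j y h]

theorem IsAssociatedMap.strictMonoOn {T : ℝ → ℝ} (H : IsNonNullLaw (P.map past0) p ε)
    (hT : IsAssociatedMap P T) (j : Fin K) : StrictMonoOn T (piece (chainSubdiv P) j) := by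
  intro s hs t ht hst
  obtain ⟨x, rfl⟩ := exists_consPast_of_mem_piece H hs
  obtain ⟨y, rfl⟩ := exists_consPast_of_mem_piece H ht
  rw [hT.apply H hs, hT.apply H ht]
  exact (H.cdf_consPast_lt_iff j).1 hst

end

/-! ### Cylinders as intervals -/

/-- The interior of the image of the cylinder of `w` under the distribution function. -/
def wordIoo (μ : Measure (Past K)) (hK : 0 < K) (w : List (Fin K)) : Set ℝ :=
  Ioo (lexCdf μ (app w (botPast hK))) (lexCdf μ (app w (topPast hK)))

namespace IsNonNullLaw

variable {μ : Measure (Past K)} {p : Fin K → Past K → ℝ} {ε : ℝ}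

theorem mem_cyl_of_mem_wordIoo (H : IsNonNullLaw μ p ε) {w : List (Fin K)} {x : Past K}
    (h : lexCdf μ x ∈ wordIoo μ H.pos w) : x ∈ cyl (Sum.inl w) :=
  (mem_cyl_iff_lex H.pos).2 ⟨(H.lexLT_of_cdf_lt h.1).le, (H.lexLT_of_cdf_lt h.2).le⟩

theorem wordIoo_nonempty (H : IsNonNullLaw μ p ε) (w : List (Fin K)) :
    lexCdf μ (app w (botPast H.pos)) < lexCdf μ (app w (topPast H.pos)) :=
  (H.cdf_app_lt_iff w).2 H.cdf_bot_lt_top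

theorem wordIoo_nil (H : IsNonNullLaw μ p ε) : wordIoo μ H.pos [] = Ioo 0 1 := by
  rw [wordIoo, app_nil, app_nil, H.cdf_botPast, H.cdf_topPast]

theorem wordIoo_subset (H : IsNonNullLaw μ p ε) (w : List (Fin K)) :
    wordIoo μ H.pos w ⊆ Icc 0 1 :=
  fun _ ht => ⟨(H.cdf_mem_Icc _).1.trans ht.1.le, ht.2.le.trans (H.cdf_mem_Icc _).2⟩

theorem consPast_mem_wordIoo (H : IsNonNullLaw μ p ε) {a : Fin K} {w : List (Fin K)} {x : Past K} :
    lexCdf μ (consPast a x) ∈ wordIoo μ H.pos (a :: w) ↔ lexCdf μ x ∈ wordIoo μ H.pos w := by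
  simp only [wordIoo, app_cons, mem_Ioo, H.cdf_consPast_lt_iff]

theorem volume_wordIoo (H : IsNonNullLaw μ p ε) (w : List (Fin K)) :
    volume (wordIoo μ H.pos w) = μ (cyl (Sum.inl w)) := by
  have := H.prob
  have hle := app_le_app (w := w).2 (botPast_le H.pos (topPast H.pos))
  rw [wordIoo, Real.volume_Ioo, H.cdf_sub hle, measureReal_def,
    ENNReal.ofReal_toReal (measure_ne_top _ _)]
  -- the cylinder is the half-open interval together with its least element, which is not an atom
  have h0 : μ {app w (botPast H.pos)} = 0 := by
    have := H.measureReal_singleton (app w (botPast H.pos))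
    rwa [measureReal_eq_zero_iff] at this
  refine le_antisymm (measure_mono fun z hz => (mem_cyl_iff_lex H.pos).2 ⟨hz.1.le, hz.2⟩) ?_
  calc μ (cyl (Sum.inl w))
      ≤ μ ({app w (botPast H.pos)} ∪ lexIoc (app w (botPast H.pos)) (app w (topPast H.pos))) := by
        refine measure_mono fun z hz => ?_
        obtain ⟨h1, h2⟩ := (mem_cyl_iff_lex H.pos).1 hz
        rcases lexLE_iff_eq_or_lexLT.1 h1 with h | h
        · exact Or.inl h.symm
        · exact Or.inr ⟨h, h2⟩
    _ ≤ _ := (measure_union_le _ _).trans (by rw [h0, zero_add])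

end IsNonNullLaw

variable {P : Measure (ℤ → Fin K)} {p : Fin K → Past K → ℝ} {ε : ℝ}

theorem leb_apply_of_subset {s : Set ℝ} (hs : s ⊆ Icc 0 1) : leb s = volume s := by
  rw [leb, Measure.restrict_eq_self _ hs]

/-- On the interval of `a w`, where `w` is a finite context, the map is affine with slope
`1 / q(a|w)`. -/
theorem IsAssociatedMap.affine {T : ℝ → ℝ} (H : IsNonNullLaw (P.map past0) p ε)
    (hT : IsAssociatedMap P T) {a : Fin K} {w : List (Fin K)} {q : ℝ}
    (hq : ∀ x ∈ cyl (Sum.inl w), p a x = q) :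
    ∃ α β : ℝ, ∀ ω ∈ wordIoo (P.map past0) H.pos (a :: w), T ω = α * ω + β := by
  have := H.prob
  set h := lexCdf (P.map past0)
  set x₀ := app w (botPast H.pos)
  have hq0 : 0 < q := by
    rw [← hq x₀ (app_mem_cyl w _)]; exact H.eps_pos.trans_le (H.eps_le _ _)
  refine ⟨q⁻¹, h x₀ - q⁻¹ * h (consPast a x₀), fun ω hω => ?_⟩
  obtain ⟨x, rfl⟩ := H.exists_cdf_eq (H.wordIoo_subset _ hω)
  obtain ⟨h0, hx⟩ := mem_cyl_cons.1 (H.mem_cyl_of_mem_wordIoo hω)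
  rw [← consPast_shiftPast x, h0] at hω ⊢
  set y := shiftPast x
  have hy : h y ∈ wordIoo (P.map past0) H.pos w := H.consPast_mem_wordIoo.1 hω
  have hle : lexLE x₀ y := ((mem_cyl_iff_lex H.pos).1 hx).1
  rw [hT.apply H ((consPast_mem_piece H).2 ⟨?_, ?_⟩)]
  · have h1 := H.cdf_consPast_sub a hle
    have h2 : ∫ z in lexIoc x₀ y, p a z ∂(P.map past0) =
        ∫ z in lexIoc x₀ y, q ∂(P.map past0) := by
      refine setIntegral_congr_fun (measurableSet_lexIoc _ _) fun z hz => hq z ?_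
      exact (mem_cyl_iff_lex H.pos).2
        ⟨hz.1.le, hz.2.trans ((mem_cyl_iff_lex H.pos).1 hx).2⟩
    rw [h2, setIntegral_const, ← H.cdf_sub hle, smul_eq_mul] at h1
    change h y = q⁻¹ * h (consPast a y) + (h x₀ - q⁻¹ * h (consPast a x₀))
    have h3 : h (consPast a y) - h (consPast a x₀) = (h y - h x₀) * q := h1
    field_simp
    linarith
  · exact (H.cdf_mem_Icc _).1.trans_lt hy.1
  · exact hy.2.trans_le (H.cdf_mem_Icc _).2

theorem pairwise_disjoint_wordIoo (H : IsNonNullLaw (P.map past0) p ε) {τ : Set (PastString K)}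
    (hτ : IsContextTree τ) :
    Pairwise fun i j : Fin K × {w : List (Fin K) // Sum.inl w ∈ τ} =>
      Disjoint (wordIoo (P.map past0) H.pos (i.1 :: i.2.1))
        (wordIoo (P.map past0) H.pos (j.1 :: j.2.1)) := by
  rintro ⟨a, w, hw⟩ ⟨b, v, hv⟩ hne
  refine Set.disjoint_left.2 fun t ht ht' => hne ?_
  obtain ⟨x, rfl⟩ := H.exists_cdf_eq (H.wordIoo_subset _ ht)
  obtain ⟨h0, hx⟩ := mem_cyl_cons.1 (H.mem_cyl_of_mem_wordIoo ht)
  obtain ⟨h0', hx'⟩ := mem_cyl_cons.1 (H.mem_cyl_of_mem_wordIoo ht')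
  have hwv : w = v := by
    by_contra hne
    have := hτ.disjoint _ hw _ hv (fun h => hne (Sum.inl.inj h))
    exact this.subset ⟨hx, hx'⟩
  subst hwv
  exact Prod.ext (h0.symm.trans h0') rfl

theorem disjoint_cyl {τ : Set (PastString K)} (hτ : IsContextTree τ) :
    Pairwise fun i j : {w : List (Fin K) // Sum.inl w ∈ τ} =>
      Disjoint (cyl (Sum.inl i.1)) (cyl (Sum.inl j.1)) := fun i j hne =>
  Set.disjoint_iff_inter_eq_empty.2
    (hτ.disjoint _ i.2 _ j.2 fun h => hne (Subtype.ext (Sum.inl.inj h)))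

instance isProbabilityMeasure_leb : IsProbabilityMeasure leb :=
  ⟨by simp [leb]⟩

theorem measure_iUnion_context {τ : Set (PastString K)} (hP : IsProbabilityMeasure P)
    (hfin : FiniteContextsAS τ P) :
    P.map past1 (⋃ w : {w : List (Fin K) // Sum.inl w ∈ τ}, cyl (Sum.inl w.1)) = 1 := by
  rw [Measure.map_apply measurable_past1 (MeasurableSet.iUnion fun w => measurableSet_cyl _),
    ← prob_compl_eq_zero_iff
      (measurable_past1 (MeasurableSet.iUnion fun w => measurableSet_cyl _))]
  change ∀ᵐ z ∂P, z ∈ past1 ⁻¹' ⋃ w : {w : List (Fin K) // Sum.inl w ∈ τ}, cyl (Sum.inl w.1)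
  filter_upwards [hfin] with z hz
  obtain ⟨w, hw, hz⟩ := hz
  exact mem_iUnion.2 ⟨⟨w, hw⟩, hz⟩

theorem leb_iUnion_wordIoo (H : IsNonNullLaw (P.map past0) p ε) {τ : Set (PastString K)}
    (hτ : IsContextTree τ) (hP : IsProbabilityMeasure P) (hfin : FiniteContextsAS τ P) :
    leb (⋃ i : Fin K × {w : List (Fin K) // Sum.inl w ∈ τ},
      wordIoo (P.map past0) H.pos (i.1 :: i.2.1)) = 1 := by
  have := H.prob
  have hdisj : Pairwise fun i j : Fin K × {w : List (Fin K) // Sum.inl w ∈ τ} =>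
      Disjoint (cyl (Sum.inl (i.1 :: i.2.1))) (cyl (Sum.inl (j.1 :: j.2.1))) := by
    intro i j hne
    refine Set.disjoint_left.2 fun x hx hx' => ?_
    obtain ⟨h0, hx⟩ := mem_cyl_cons.1 hx
    obtain ⟨h0', hx'⟩ := mem_cyl_cons.1 hx'
    by_cases h : i.2 = j.2
    · exact hne (Prod.ext (h0.symm.trans h0') h)
    · exact Set.disjoint_left.1 (disjoint_cyl hτ h) hx hx'
  rw [leb_apply_of_subset (iUnion_subset fun i => H.wordIoo_subset _),
    measure_iUnion (pairwise_disjoint_wordIoo H hτ) fun i => measurableSet_Ioo]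
  simp only [H.volume_wordIoo]
  rw [← measure_iUnion hdisj fun i => measurableSet_cyl _,
    Measure.map_apply measurable_past0 (MeasurableSet.iUnion fun i => measurableSet_cyl _)]
  refine le_antisymm prob_le_one ?_
  rw [← measure_iUnion_context hP hfin,
    Measure.map_apply measurable_past1 (MeasurableSet.iUnion fun w => measurableSet_cyl _)]
  refine measure_mono fun z hz => ?_
  obtain ⟨w, hw⟩ := mem_iUnion.1 hz
  refine mem_iUnion.2 ⟨(past0 z 0, w), mem_cyl_cons.2 ⟨rfl, ?_⟩⟩
  rwa [shiftPast_past0]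

theorem IsAssociatedMap.isPiecewiseAffine {T : ℝ → ℝ} (H : IsNonNullLaw (P.map past0) p ε)
    (hT : IsAssociatedMap P T) {τ : Set (PastString K)} (hτ : IsContextTree τ)
    (hvl : HasVariableLength τ p) (hP : IsProbabilityMeasure P) (hfin : FiniteContextsAS τ P) :
    IsPiecewiseAffine (Fin K × {w : List (Fin K) // Sum.inl w ∈ τ}) T := by
  obtain ⟨q, hq⟩ := hvl
  refine ⟨_, _, fun i => ⟨H.wordIoo_nonempty (i.1 :: i.2.1), H.wordIoo_subset _⟩,
    pairwise_disjoint_wordIoo H hτ, ?_, fun i =>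
      hT.affine H fun x hx => hq ⟨Sum.inl i.2.1, i.2.2⟩ x hx i.1⟩
  rw [prob_compl_eq_zero_iff (MeasurableSet.iUnion fun _ => measurableSet_Ioo)]
  exact leb_iUnion_wordIoo H hτ hP hfin

/-! ### Codes of the associated map -/

theorem exists_mem_piece {η : Fin (K + 1) → ℝ} (hη : IsSubdivision η) {t : ℝ}
    (ht : t ∈ Icc (0 : ℝ) 1) (hne : t ∉ range η) : ∃ j, t ∈ piece η j := by
  by_contra hcon
  push Not at hcon
  have key : ∀ j : Fin (K + 1), η j < t := by
    intro j
    induction j using Fin.induction with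
    | zero =>
      rw [hη.zero]
      exact lt_of_le_of_ne ht.1 fun h => hne ⟨0, by rw [hη.zero, h]⟩
    | succ j ih =>
      have := hcon j
      rw [piece, mem_Ioo, not_and, not_lt] at this
      exact lt_of_le_of_ne (this ih) fun h => hne ⟨_, h⟩
  have := key (Fin.last K)
  rw [hη.last] at this
  exact this.not_ge ht.2

theorem apply_mem_codable {η : Fin (K + 1) → ℝ} {T : ℝ → ℝ} {ω : ℝ} (h : ω ∈ codable η T)
    (hT : T ω ∈ Icc (0 : ℝ) 1) : T ω ∈ codable η T :=
  ⟨hT, fun k => by rw [← Function.iterate_succ_apply]; exact h.2 (k + 1)⟩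

theorem codeCyl_nil {η : Fin (K + 1) → ℝ} {T : ℝ → ℝ} : codeCyl η T [] = codable η T := by
  ext ω; simp [codeCyl]

theorem mem_codeCyl_cons {η : Fin (K + 1) → ℝ} {T : ℝ → ℝ}
    (hT : ∀ j, MapsTo T (piece η j) (Icc 0 1)) {a : Fin K} {w : List (Fin K)} {ω : ℝ} :
    ω ∈ codeCyl η T (a :: w) ↔ ω ∈ codable η T ∧ ω ∈ piece η a ∧ T ω ∈ codeCyl η T w := by
  constructor
  · rintro ⟨hc, h⟩
    have h0 : ω ∈ piece η a := h 0 (by simp)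
    refine ⟨hc, h0, apply_mem_codable hc (hT a h0), fun i hi => ?_⟩
    rw [← Function.iterate_succ_apply]
    exact h (i + 1) (by simpa using hi)
  · rintro ⟨hc, h0, -, h⟩
    refine ⟨hc, fun i hi => ?_⟩
    cases i with
    | zero => exact h0
    | succ i =>
      rw [Function.iterate_succ_apply]
      exact h i (by simpa using hi)

theorem piece_subset_Icc {η : Fin (K + 1) → ℝ} (hη : IsSubdivision η) (j : Fin K) :
    piece η j ⊆ Icc 0 1 := fun t ht => by
  have h1 := hη.strictMono.monotone (Fin.zero_le j.castSucc)
  have h2 := hη.strictMono.monotone (Fin.le_last j.succ)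
  rw [hη.zero] at h1
  rw [hη.last] at h2
  exact ⟨h1.trans ht.1.le, ht.2.le.trans h2⟩

theorem IsAssociatedMap.mapsTo {T : ℝ → ℝ} (H : IsNonNullLaw (P.map past0) p ε)
    (hT : IsAssociatedMap P T) (j : Fin K) : MapsTo T (piece (chainSubdiv P) j) (Icc 0 1) := by
  intro t ht
  obtain ⟨y, rfl⟩ := exists_consPast_of_mem_piece H ht
  rw [hT.apply H ht]
  exact H.cdf_mem_Icc y

/-- Only countably many points have an orbit that meets the subdivision, as the map is injective on
each piece. -/
theorem IsAssociatedMap.countable_not_codable {T : ℝ → ℝ} (H : IsNonNullLaw (P.map past0) p ε)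
    (hT : IsAssociatedMap P T) : (Icc 0 1 \ codable (chainSubdiv P) T).Countable := by
  have key : ∀ k : ℕ, {ω ∈ Icc (0 : ℝ) 1 | (∀ i < k, T^[i] ω ∉ range (chainSubdiv P)) ∧
      T^[k] ω ∈ range (chainSubdiv P)}.Countable := by
    intro k
    induction k with
    | zero => exact (Set.finite_range (chainSubdiv P)).countable.mono fun ω hω => hω.2.2
    | succ k ih =>
      have hj : ∀ j, (piece (chainSubdiv P) j ∩ T ⁻¹' {ω ∈ Icc (0 : ℝ) 1 |
          (∀ i < k, T^[i] ω ∉ range (chainSubdiv P)) ∧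
          T^[k] ω ∈ range (chainSubdiv P)}).Countable := fun j =>
        MapsTo.countable_of_injOn (f := T) (fun ω hω => hω.2)
          ((hT.strictMonoOn H j).injOn.mono inter_subset_left) ih
      refine (countable_iUnion hj).mono ?_
      rintro ω ⟨h01, hlt, hk⟩
      obtain ⟨j, hj⟩ := exists_mem_piece (isSubdivision_chainSubdiv H) h01 (hlt 0 (by omega))
      refine mem_iUnion.2 ⟨j, hj, hT.mapsTo H j hj, fun i hi => ?_, ?_⟩
      · rw [← Function.iterate_succ_apply]; exact hlt (i + 1) (by omega)
      · rw [← Function.iterate_succ_apply]; exact hk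
  refine (countable_iUnion key).mono ?_
  classical
  rintro ω ⟨h01, hω⟩
  have hex : ∃ k, T^[k] ω ∈ range (chainSubdiv P) := by
    by_contra h
    push Not at h
    exact hω ⟨h01, h⟩
  exact mem_iUnion.2 ⟨Nat.find hex, h01, fun i hi => Nat.find_min hex hi, Nat.find_spec hex⟩

theorem IsAssociatedMap.codeCyl_eq {T : ℝ → ℝ} (H : IsNonNullLaw (P.map past0) p ε)
    (hT : IsAssociatedMap P T) (w : List (Fin K)) :
    codeCyl (chainSubdiv P) T w =
      codable (chainSubdiv P) T ∩ wordIoo (P.map past0) H.pos w := by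
  have hη := isSubdivision_chainSubdiv H
  induction w with
  | nil =>
    rw [codeCyl_nil, H.wordIoo_nil, eq_comm, inter_eq_left]
    intro ω hω
    exact ⟨lt_of_le_of_ne hω.1.1 fun h => hω.2 0 ⟨0, by rw [hη.zero]; exact h⟩,
      lt_of_le_of_ne hω.1.2 fun h => hω.2 0 ⟨Fin.last K, by rw [hη.last]; exact h.symm⟩⟩
  | cons a w ih =>
    ext ω
    rw [mem_codeCyl_cons (hT.mapsTo H), ih]
    constructor
    · rintro ⟨hc, h0, -, h⟩
      refine ⟨hc, ?_⟩
      obtain ⟨y, rfl⟩ := exists_consPast_of_mem_piece H h0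
      rw [hT.apply H h0] at h
      exact H.consPast_mem_wordIoo.2 h
    · rintro ⟨hc, h⟩
      obtain ⟨j, hj⟩ := exists_mem_piece hη hc.1 (hc.2 0)
      obtain ⟨y, rfl⟩ := exists_consPast_of_mem_piece H hj
      obtain ⟨rfl, -⟩ := mem_cyl_cons.1 (H.mem_cyl_of_mem_wordIoo h)
      refine ⟨hc, hj, apply_mem_codable hc (hT.mapsTo H _ hj), ?_⟩
      rw [consPast_zero] at h
      rw [hT.apply H hj]
      exact H.consPast_mem_wordIoo.1 h

theorem IsAssociatedMap.leb_codeCyl {T : ℝ → ℝ} (H : IsNonNullLaw (P.map past0) p ε)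
    (hT : IsAssociatedMap P T) (w : List (Fin K)) :
    leb (codeCyl (chainSubdiv P) T w) = P.map past0 (cyl (Sum.inl w)) := by
  rw [hT.codeCyl_eq H, ← H.volume_wordIoo]
  have hsub := H.wordIoo_subset w
  rw [leb_apply_of_subset (inter_subset_right.trans hsub)]
  refine le_antisymm (measure_mono inter_subset_right) ?_
  have h0 := (hT.countable_not_codable H).measure_zero volume
  rw [← measure_sdiff_null h0 (s := wordIoo (P.map past0) H.pos w)]
  refine measure_mono ?_
  rintro ω ⟨h1, h2⟩
  exact ⟨by_contra fun h => h2 ⟨hsub h1, h⟩, h1⟩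

theorem map_of_chain (hK : 2 ≤ K) (τ : Set (PastString K)) (hp : IsTransitionFamily p)
    (hnn : NonNull p) (hτ : IsContextTree τ) (hvl : HasVariableLength τ p)
    (hP : IsProbabilityMeasure P) (hs : Stationary P) (hinv : InvariantFor p P)
    (hfin : FiniteContextsAS τ P) :
    IsSubdivision (chainSubdiv P) ∧ (∃ T : ℝ → ℝ, IsAssociatedMap P T) ∧
      ∀ T : ℝ → ℝ, IsAssociatedMap P T →
        (∀ j, StrictMonoOn T (piece (chainSubdiv P) j)) ∧
        IsPiecewiseAffine (Fin K × {w : List (Fin K) // Sum.inl w ∈ τ}) T ∧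
        (∀ w : List (Fin K), Sum.inl w ∈ τ → ∀ a : Fin K,
          ∀ ω ∈ codeCyl (chainSubdiv P) T (a :: w), DifferentiableAt ℝ T ω) ∧
        DerivConstOnContexts (chainSubdiv P) T τ ∧
        FiniteContextsFull (chainSubdiv P) T τ := by
  obtain ⟨ε, hε, hle⟩ := hnn
  have H := isNonNullLaw hK hp hε hle hP hs hinv
  obtain ⟨T₀, hT₀, -⟩ := exists_isAssociatedMap H
  refine ⟨isSubdivision_chainSubdiv H, ⟨T₀, hT₀⟩, fun T hT => ?_⟩
  -- the points with code `a w` lie in an open interval on which the map is affine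
  have hderiv : ∀ w : List (Fin K), Sum.inl w ∈ τ → ∀ a : Fin K, ∃ α : ℝ,
      ∀ ω ∈ codeCyl (chainSubdiv P) T (a :: w), HasDerivAt T α ω := by
    intro w hw a
    obtain ⟨q, hq⟩ := hvl
    obtain ⟨α, β, h⟩ := hT.affine H fun x hx => hq ⟨Sum.inl w, hw⟩ x hx a
    refine ⟨α, fun ω hω => ?_⟩
    rw [hT.codeCyl_eq H] at hω
    have h1 : HasDerivAt (fun ω => α * ω + β) α ω := by
      simpa using ((hasDerivAt_id ω).const_mul α).add_const β
    refine h1.congr_of_eventuallyEq ?_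
    filter_upwards [isOpen_Ioo.mem_nhds hω.2] with t ht using h t ht
  refine ⟨hT.strictMonoOn H, hT.isPiecewiseAffine H hτ hvl hP hfin, fun w hw a ω hω => ?_,
    fun w hw a ω hω ω' hω' => ?_, ?_⟩
  · obtain ⟨α, h⟩ := hderiv w hw a
    exact (h ω hω).differentiableAt
  · obtain ⟨α, h⟩ := hderiv w hw a
    rw [(h ω hω).deriv, (h ω' hω').deriv]
  · rw [FiniteContextsFull]
    simp only [hT.leb_codeCyl H]
    rw [← measure_iUnion (disjoint_cyl hτ) fun w => measurableSet_cyl _, ← hs.map_past1,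
      measure_iUnion_context hP hfin]

/-! ### Piecewise monotone maps: orbits and branches -/

theorem IsSubdivision.pos {η : Fin (K + 1) → ℝ} (hη : IsSubdivision η) : 0 < K := by
  rcases Nat.eq_zero_or_pos K with rfl | h
  · have h1 := hη.zero
    have h2 := hη.last
    rw [show Fin.last 0 = 0 from rfl, h1] at h2
    exact absurd h2 zero_ne_one
  · exact h

theorem eq_of_mem_piece {η : Fin (K + 1) → ℝ} (hη : IsSubdivision η) {i j : Fin K} {t : ℝ}
    (hi : t ∈ piece η i) (hj : t ∈ piece η j) : i = j := by
  have key : ∀ {i j : Fin K}, t ∈ piece η i → t ∈ piece η j → ¬i < j := by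
    intro i j hi hj h
    have : i.succ ≤ j.castSucc := Fin.le_def.2 (by simpa using Fin.lt_def.1 h)
    exact (hi.2.trans_le (hη.strictMono.monotone this)).not_gt hj.1
  exact le_antisymm (not_lt.1 (key hj hi)) (not_lt.1 (key hi hj))

theorem notMem_range_of_mem_piece {η : Fin (K + 1) → ℝ} (hη : IsSubdivision η) {j : Fin K} {t : ℝ}
    (h : t ∈ piece η j) : t ∉ range η := by
  rintro ⟨i, rfl⟩
  have h1 := Fin.lt_def.1 (hη.strictMono.lt_iff_lt.1 h.1)
  have h2 := Fin.lt_def.1 (hη.strictMono.lt_iff_lt.1 h.2)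
  simp only [Fin.val_castSucc, Fin.val_succ] at h1 h2
  omega

theorem codable_iterate {η : Fin (K + 1) → ℝ} {T : ℝ → ℝ} (hη : IsSubdivision η)
    (hT : ∀ j, MapsTo T (piece η j) (Icc 0 1)) {ω : ℝ} (hω : ω ∈ codable η T) (k : ℕ) :
    T^[k] ω ∈ codable η T := by
  induction k with
  | zero => exact hω
  | succ k ih =>
    rw [Function.iterate_succ_apply']
    obtain ⟨j, hj⟩ := exists_mem_piece hη ih.1 (ih.2 0)
    exact apply_mem_codable ih (hT j hj)

theorem codable_of_apply {η : Fin (K + 1) → ℝ} {T : ℝ → ℝ} (hη : IsSubdivision η) {b : Fin K}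
    {ω : ℝ} (hb : ω ∈ piece η b) (h : T ω ∈ codable η T) : ω ∈ codable η T := by
  refine ⟨piece_subset_Icc hη b hb, fun k => ?_⟩
  cases k with
  | zero => exact notMem_range_of_mem_piece hη hb
  | succ k => rw [Function.iterate_succ_apply]; exact h.2 k

theorem codeCyl_mono {η : Fin (K + 1) → ℝ} {T : ℝ → ℝ} {v w : List (Fin K)} (h : v <+: w) :
    codeCyl η T w ⊆ codeCyl η T v := by
  rintro ω ⟨hc, hω⟩
  refine ⟨hc, fun i hi => ?_⟩
  have := hω i (hi.trans_le h.length_le)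
  rwa [h.getElem hi]

theorem ae_codable {η : Fin (K + 1) → ℝ} {T : ℝ → ℝ} (hT : MeasurePreserving T leb leb) :
    ∀ᵐ ω ∂leb, ω ∈ codable η T := by
  have h1 : ∀ᵐ ω ∂leb, ω ∈ Icc (0 : ℝ) 1 := ae_restrict_mem measurableSet_Icc
  have h2 : ∀ k : ℕ, ∀ᵐ ω ∂leb, T^[k] ω ∉ range η := by
    intro k
    have h0 : ∀ᵐ ω ∂leb, ω ∉ range η := by
      rw [leb]
      exact ae_restrict_of_ae ((Set.finite_range η).countable.ae_notMem volume)
    exact (hT.iterate k).quasiMeasurePreserving.ae h0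
  filter_upwards [h1, ae_all_iff.2 h2] with ω h h' using ⟨h, h'⟩

theorem exists_codable_mem {η : Fin (K + 1) → ℝ} {T : ℝ → ℝ} (hT : MeasurePreserving T leb leb)
    {V : Set ℝ} (hV : IsOpen V) (hne : V.Nonempty) (hsub : V ⊆ Icc 0 1) :
    ∃ t ∈ V, t ∈ codable η T := by
  by_contra h
  push Not at h
  have h0 : leb V = 0 := measure_mono_null (fun t ht => h t ht) (ae_codable (η := η) hT)
  rw [leb_apply_of_subset hsub] at h0
  exact (hV.measure_pos volume hne).ne' h0

namespace IsMarkovExpanding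

variable {η : Fin (K + 1) → ℝ} {T : ℝ → ℝ}

theorem exists_deriv (hM : IsMarkovExpanding η T) (j : Fin K) :
    ∃ g : ℝ → ℝ, ContinuousOn g (Icc (η j.castSucc) (η j.succ)) ∧
      ∀ ω ∈ piece η j, HasDerivAt T (g ω) ω := by
  obtain ⟨f, hf, hfT⟩ := hM.extends_C2 j
  have hlt : η j.castSucc < η j.succ := hM.subdivision.strictMono j.castSucc_lt_succ
  refine ⟨derivWithin f (Icc (η j.castSucc) (η j.succ)),
    hf.continuousOn_derivWithin (uniqueDiffOn_Icc hlt) (by norm_num), fun ω hω => ?_⟩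
  have h1 := (hf.differentiableOn (by norm_num) ω (Ioo_subset_Icc_self hω)).hasDerivWithinAt
  refine (h1.hasDerivAt (Icc_mem_nhds hω.1 hω.2)).congr_of_eventuallyEq ?_
  filter_upwards [isOpen_Ioo.mem_nhds hω] with t ht using hfT ht

theorem hasDerivAt (hM : IsMarkovExpanding η T) {j : Fin K} {ω : ℝ} (hω : ω ∈ piece η j) :
    HasDerivAt T (deriv T ω) ω := by
  obtain ⟨g, -, hg⟩ := hM.exists_deriv j
  exact (hg ω hω).differentiableAt.hasDerivAt

theorem continuousOn (hM : IsMarkovExpanding η T) (j : Fin K) : ContinuousOn T (piece η j) :=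
  fun _ hω => (hM.hasDerivAt hω).continuousAt.continuousWithinAt

theorem hasDerivAt_iterate (hM : IsMarkovExpanding η T) {ω : ℝ} (n : ℕ)
    (h : ∀ k < n, ∃ j, T^[k] ω ∈ piece η j) :
    HasDerivAt T^[n] (∏ k ∈ Finset.range n, deriv T (T^[k] ω)) ω := by
  induction n with
  | zero => simpa using hasDerivAt_id ω
  | succ n ih =>
    obtain ⟨j, hj⟩ := h n (by omega)
    rw [Function.iterate_succ', Finset.prod_range_succ, mul_comm]
    exact (hM.hasDerivAt hj).comp ω (ih fun k hk => h k (by omega))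

theorem exists_deriv_le (hM : IsMarkovExpanding η T) :
    ∃ M : ℝ, 1 ≤ M ∧ ∀ j, ∀ ω ∈ piece η j, |deriv T ω| ≤ M := by
  have h : ∀ j, ∃ M : ℝ, ∀ ω ∈ piece η j, |deriv T ω| ≤ M := by
    intro j
    obtain ⟨g, hg, hgT⟩ := hM.exists_deriv j
    obtain ⟨M, hM⟩ := isCompact_Icc.exists_bound_of_continuousOn hg
    refine ⟨M, fun ω hω => ?_⟩
    rw [(hgT ω hω).deriv]
    exact hM ω (Ioo_subset_Icc_self hω)
  choose M hM using h
  refine ⟨1 + ∑ j, |M j|, ?_, fun j ω hω => ?_⟩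
  · linarith [Finset.sum_nonneg fun j (_ : j ∈ Finset.univ) => abs_nonneg (M j)]
  · have h1 := Finset.single_le_sum (f := fun j => |M j|) (fun j _ => abs_nonneg (M j))
      (Finset.mem_univ j)
    have h2 := hM j ω hω
    have h3 := le_abs_self (M j)
    linarith

/-- The derivative is bounded away from zero. At points with a code this follows from the expansion
of an iterate and the upper bound of the derivative along the orbit; such points are dense. -/
theorem exists_le_deriv (hM : IsMarkovExpanding η T) (hT : MeasurePreserving T leb leb) :
    ∃ δ : ℝ, 0 < δ ∧ ∀ j, ∀ ω ∈ piece η j, δ ≤ |deriv T ω| := by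
  obtain ⟨M, hM1, hMb⟩ := hM.exists_deriv_le
  obtain ⟨m, c, hm, hc, hexp⟩ := hM.expanding
  obtain ⟨n, rfl⟩ : ∃ n, m = n + 1 := ⟨m - 1, by omega⟩
  have hMn : 0 < M ^ n := pow_pos (by linarith) n
  have hcod : ∀ ω ∈ codable η T, 1 / M ^ n ≤ |deriv T ω| := by
    intro ω hω
    have hp : ∀ k, ∃ j, T^[k] ω ∈ piece η j := fun k =>
      have h := codable_iterate hM.subdivision hM.mapsTo hω k
      exists_mem_piece hM.subdivision h.1 (h.2 0)
    have hd := hM.hasDerivAt_iterate (n + 1) fun k _ => hp k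
    have h1 := hexp ω hω.1 (fun k _ => hω.2 k) hd.differentiableAt
    rw [hd.deriv, Finset.prod_range_succ', abs_mul, Finset.abs_prod] at h1
    have h2 : ∏ k ∈ Finset.range n, |deriv T (T^[k + 1] ω)| ≤ M ^ n := by
      refine (Finset.prod_le_prod (fun _ _ => abs_nonneg _) fun k _ => ?_).trans
        (by rw [Finset.prod_const, Finset.card_range])
      obtain ⟨j, hj⟩ := hp (k + 1)
      exact hMb j _ hj
    rw [Function.iterate_zero, id] at h1
    rw [div_le_iff₀ hMn]
    have h3 := mul_le_mul_of_nonneg_right h2 (abs_nonneg (deriv T ω))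
    linarith
  refine ⟨1 / M ^ n, by positivity, fun j ω hω => ?_⟩
  obtain ⟨g, hg, hgT⟩ := hM.exists_deriv j
  by_contra hlt
  rw [not_le, (hgT ω hω).deriv] at hlt
  have hcont : ContinuousOn (fun t => |g t|) (piece η j) := (hg.mono Ioo_subset_Icc_self).abs
  have hopen : IsOpen (piece η j ∩ (fun t => |g t|) ⁻¹' Iio (1 / M ^ n)) :=
    hcont.isOpen_inter_preimage isOpen_Ioo isOpen_Iio
  obtain ⟨t, ⟨ht, htg⟩, htc⟩ := exists_codable_mem (η := η) hT hopen ⟨ω, hω, hlt⟩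
    (inter_subset_left.trans (piece_subset_Icc hM.subdivision j))
  have := hcod t htc
  rw [(hgT t ht).deriv] at this
  exact this.not_gt htg

theorem injOn (hM : IsMarkovExpanding η T) (hT : MeasurePreserving T leb leb) (j : Fin K) :
    InjOn T (piece η j) := by
  obtain ⟨δ, hδ, hd⟩ := hM.exists_le_deriv hT
  have key : ∀ s ∈ piece η j, ∀ t ∈ piece η j, T s = T t → ¬s < t := by
    intro s hs t ht hst hlt
    have hsub : Icc s t ⊆ piece η j := fun u hu => ⟨hs.1.trans_le hu.1, hu.2.trans_lt ht.2⟩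
    obtain ⟨u, hu, hu0⟩ := exists_deriv_eq_zero hlt ((hM.continuousOn j).mono hsub) hst
    have := hd j u (hsub (Ioo_subset_Icc_self hu))
    rw [hu0, abs_zero] at this
    linarith
  intro s hs t ht hst
  exact le_antisymm (not_lt.1 (key t ht s hs hst.symm)) (not_lt.1 (key s hs t ht hst))

theorem ordConnected_image (hM : IsMarkovExpanding η T) (j : Fin K) :
    OrdConnected (T '' piece η j) :=
  (isPreconnected_Ioo.image T (hM.continuousOn j)).ordConnected

theorem image_subset_Icc (hM : IsMarkovExpanding η T) (j : Fin K) : T '' piece η j ⊆ Icc 0 1 :=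
  (hM.mapsTo j).image_subset

/-- The image of a piece, an interval whose closure is a union of closed pieces, contains each open
piece that it meets. -/
theorem subset_image_or_disjoint (hM : IsMarkovExpanding η T) (b j : Fin K) :
    piece η j ⊆ T '' piece η b ∨ Disjoint (T '' piece η b) (piece η j) := by
  obtain ⟨S, hS⟩ := hM.markov b
  have hlt : ∀ i : Fin K, η i.castSucc < η i.succ := fun i =>
    hM.subdivision.strictMono i.castSucc_lt_succ
  by_cases hj : j ∈ S
  · left
    have hcl : piece η j ⊆ closure (T '' piece η b) := by
      rw [hS]
      exact subset_closure.trans (subset_biUnion_of_mem (u := fun j => closure (piece η j)) hj)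
    intro t ht
    obtain ⟨s, hs⟩ := nonempty_Ioo.2 ht.1
    obtain ⟨u, hu⟩ := nonempty_Ioo.2 ht.2
    obtain ⟨s', hs', hsT⟩ := mem_closure_iff.1 (hcl ⟨hs.1, hs.2.trans ht.2⟩) _ isOpen_Ioo hs
    obtain ⟨u', hu', huT⟩ := mem_closure_iff.1 (hcl ⟨ht.1.trans hu.1, hu.2⟩) _ isOpen_Ioo hu
    exact (hM.ordConnected_image b).out hsT huT ⟨hs'.2.le, hu'.1.le⟩
  · right
    refine Set.disjoint_left.2 fun t ht htj => ?_
    have ht' : t ∈ closure (T '' piece η b) := subset_closure ht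
    rw [hS] at ht'
    obtain ⟨i, hi, hti⟩ := mem_iUnion₂.1 ht'
    -- an open set which meets the closure of a piece meets the piece
    obtain ⟨s, hs1, hs2⟩ := mem_closure_iff.1 hti _ isOpen_Ioo htj
    exact hj (eq_of_mem_piece hM.subdivision hs1 hs2 ▸ hi)

/-- Codes extend freely to the front as long as the transition from `b` to their first symbol is
possible. -/
theorem exists_mem_codeCyl_cons (hM : IsMarkovExpanding η T) {b : Fin K} {w : List (Fin K)} {y : ℝ}
    (hy : y ∈ codeCyl η T w) (hyb : y ∈ T '' piece η b) :
    ∃ ω ∈ codeCyl η T (b :: w), T ω = y := by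
  obtain ⟨ω, hω, rfl⟩ := hyb
  exact ⟨ω, (mem_codeCyl_cons hM.mapsTo).2 ⟨codable_of_apply hM.subdivision hω hy.1, hω, hy⟩, rfl⟩

/-- A cylinder of codes is null only if it is empty: the branch at its first symbol maps it onto the
next cylinder. -/
theorem leb_codeCyl_pos (hM : IsMarkovExpanding η T) (hT : MeasurePreserving T leb leb)
    {w : List (Fin K)} (hw : (codeCyl η T w).Nonempty) : leb (codeCyl η T w) ≠ 0 := by
  induction w with
  | nil =>
    rw [codeCyl_nil]
    intro h
    have h1 : leb (univ : Set ℝ) = 0 := by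
      refine le_antisymm ?_ zero_le
      rw [← union_compl_self (codable η T)]
      refine (measure_union_le _ _).trans ?_
      rw [h, zero_add]
      exact (ae_codable (η := η) hT).le
    rw [measure_univ] at h1
    exact one_ne_zero h1
  | cons a w ih =>
    cases w with
    | nil =>
      intro h
      have h1 : leb (piece η a) = 0 := by
        refine measure_mono_null (t := codeCyl η T [a] ∪ (codable η T)ᶜ) (fun t ht => ?_)
          (measure_union_null h (ae_codable (η := η) hT))
        by_cases htc : t ∈ codable η T
        · exact Or.inl ((mem_codeCyl_cons hM.mapsTo).2
            ⟨htc, ht, by rw [codeCyl_nil]; exact apply_mem_codable htc (hM.mapsTo a ht)⟩)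
        · exact Or.inr htc
      rw [leb_apply_of_subset (piece_subset_Icc hM.subdivision a), piece, Real.volume_Ioo,
        ENNReal.ofReal_eq_zero] at h1
      linarith [hM.subdivision.strictMono a.castSucc_lt_succ]
    | cons b w =>
      obtain ⟨ω, hω⟩ := hw
      obtain ⟨-, hωa, hTω⟩ := (mem_codeCyl_cons hM.mapsTo).1 hω
      have hTb : T ω ∈ piece η b := ((mem_codeCyl_cons hM.mapsTo).1 hTω).2.1
      have hsub : piece η b ⊆ T '' piece η a :=
        (hM.subset_image_or_disjoint a b).resolve_right fun h =>
          Set.disjoint_left.1 h (mem_image_of_mem T hωa) hTb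
      intro h
      have h1 : volume (codeCyl η T (a :: b :: w)) = 0 := by
        rwa [leb_apply_of_subset fun t ht => ht.1.1] at h
      -- null sets have null images under differentiable maps
      have h2 : volume (T '' codeCyl η T (a :: b :: w)) = 0 :=
        addHaar_image_eq_zero_of_differentiableOn_of_addHaar_eq_zero volume
          (fun t ht => (hM.hasDerivAt
            ((mem_codeCyl_cons hM.mapsTo).1 ht).2.1).differentiableAt.differentiableWithinAt) h1
      refine ih ⟨_, hTω⟩ ?_
      rw [leb_apply_of_subset fun t ht => ht.1.1]
      refine measure_mono_null (fun t ht => ?_) h2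
      exact hM.exists_mem_codeCyl_cons ht (hsub ((mem_codeCyl_cons hM.mapsTo).1 ht).2.1)

end IsMarkovExpanding

/-! ### Branch weights -/

open Classical in
/-- `1 / |T' ω|` at the preimage `ω` of `y` in the piece `b`, and `0` if there is none. -/
def branchWeight (η : Fin (K + 1) → ℝ) (T : ℝ → ℝ) (b : Fin K) (y : ℝ) : ℝ :=
  if h : ∃ ω ∈ piece η b, T ω = y then 1 / |deriv T h.choose| else 0

section

variable {η : Fin (K + 1) → ℝ} {T : ℝ → ℝ}

theorem branchWeight_of_notMem {b : Fin K} {y : ℝ} (h : y ∉ T '' piece η b) :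
    branchWeight η T b y = 0 := dif_neg h

theorem branchWeight_nonneg (b : Fin K) (y : ℝ) : 0 ≤ branchWeight η T b y := by
  rw [branchWeight]
  split_ifs <;> positivity

theorem sum_integral_piece (hη : IsSubdivision η) {G : ℝ → ℝ}
    (hG : Integrable G leb) : ∑ b, ∫ ω in piece η b, G ω = ∫ ω, G ω ∂leb := by
  have hae : (⋃ b, piece η b : Set ℝ) =ᵐ[volume] Icc (0 : ℝ) 1 := by
    refine (iUnion_subset fun b => piece_subset_Icc hη b).eventuallyLE.antisymm ?_
    filter_upwards [(Set.finite_range η).countable.ae_notMem volume] with t ht h01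
    obtain ⟨j, hj⟩ := exists_mem_piece hη h01 ht
    exact mem_iUnion.2 ⟨j, hj⟩
  rw [leb, ← setIntegral_congr_set hae]
  symm
  refine integral_iUnion_fintype (fun b => measurableSet_Ioo) (fun i j hij => ?_) fun b => ?_
  · exact Set.disjoint_left.2 fun t hi hj => hij (eq_of_mem_piece hη hi hj)
  · exact IntegrableOn.mono_set (s := piece η b) hG (piece_subset_Icc hη b)

end

namespace IsMarkovExpanding

variable {η : Fin (K + 1) → ℝ} {T : ℝ → ℝ}

theorem branchWeight_apply (hM : IsMarkovExpanding η T) (hT : MeasurePreserving T leb leb)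
    {b : Fin K} {ω : ℝ} (hω : ω ∈ piece η b) : branchWeight η T b (T ω) = 1 / |deriv T ω| := by
  have h : ∃ ω' ∈ piece η b, T ω' = T ω := ⟨ω, hω, rfl⟩
  rw [branchWeight, dif_pos h, hM.injOn hT b h.choose_spec.1 hω h.choose_spec.2]

theorem measurableSet_image (hM : IsMarkovExpanding η T) (hT : MeasurePreserving T leb leb)
    (b : Fin K) {s : Set ℝ} (hs : MeasurableSet s) (hsub : s ⊆ piece η b) :
    MeasurableSet (T '' s) :=
  hs.image_of_measurable_injOn hT.measurable ((hM.injOn hT b).mono hsub)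

theorem measurable_branchWeight (hM : IsMarkovExpanding η T) (hT : MeasurePreserving T leb leb)
    (b : Fin K) : Measurable (branchWeight η T b) := by
  intro C hC
  have hd : MeasurableSet (piece η b ∩ (fun ω => 1 / |deriv T ω|) ⁻¹' C) :=
    measurableSet_Ioo.inter (((measurable_deriv T).abs.const_div 1) hC)
  have h1 := hM.measurableSet_image hT b hd inter_subset_left
  have h2 : MeasurableSet ((T '' piece η b)ᶜ ∩ {_y | (0 : ℝ) ∈ C}) :=
    (hM.measurableSet_image hT b measurableSet_Ioo subset_rfl).compl.inter
      (MeasurableSet.const _)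
  convert h1.union h2 using 1
  ext y
  by_cases hy : y ∈ T '' piece η b
  · obtain ⟨ω, hω, rfl⟩ := hy
    rw [mem_preimage, hM.branchWeight_apply hT hω]
    constructor
    · exact fun h => Or.inl ⟨ω, ⟨hω, h⟩, rfl⟩
    · rintro (⟨ω', ⟨hω', h⟩, heq⟩ | h)
      · rw [← hM.injOn hT b hω' hω heq]; exact h
      · exact absurd (mem_image_of_mem T hω) h.1
  · rw [mem_preimage, branchWeight_of_notMem hy]
    constructor
    · exact fun h => Or.inr ⟨hy, h⟩
    · rintro (⟨ω', ⟨hω', h⟩, rfl⟩ | h)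
      · exact absurd (mem_image_of_mem T hω') hy
      · exact h.2

theorem integrable_branchWeight (hM : IsMarkovExpanding η T) (hT : MeasurePreserving T leb leb)
    (b : Fin K) : Integrable (branchWeight η T b) leb := by
  obtain ⟨δ, hδ, hd⟩ := hM.exists_le_deriv hT
  refine Integrable.of_bound (hM.measurable_branchWeight hT b).aestronglyMeasurable (1 / δ)
    (ae_of_all _ fun y => ?_)
  rw [Real.norm_eq_abs, abs_of_nonneg (branchWeight_nonneg b y)]
  by_cases hy : y ∈ T '' piece η b
  · obtain ⟨ω, hω, rfl⟩ := hy
    rw [hM.branchWeight_apply hT hω]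
    exact one_div_le_one_div_of_le hδ (hd b ω hω)
  · rw [branchWeight_of_notMem hy]; positivity

/-- Change of variables along the branch `b`. -/
theorem integral_branchWeight_mul (hM : IsMarkovExpanding η T) (hT : MeasurePreserving T leb leb)
    (b : Fin K) (G : ℝ → ℝ) :
    ∫ y, branchWeight η T b y * G y ∂leb = ∫ ω in piece η b, G (T ω) := by
  obtain ⟨δ, hδ, hd⟩ := hM.exists_le_deriv hT
  have h1 : ∫ y, branchWeight η T b y * G y ∂leb =
      ∫ y in T '' piece η b, branchWeight η T b y * G y := by
    rw [leb]
    refine (setIntegral_eq_of_subset_of_forall_sdiff_eq_zero measurableSet_Icc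
      (hM.image_subset_Icc b) fun y hy => ?_)
    rw [branchWeight_of_notMem hy.2, zero_mul]
  rw [h1, integral_image_eq_integral_abs_deriv_smul
    (show MeasurableSet (piece η b) from measurableSet_Ioo)
    (fun ω hω => (hM.hasDerivAt hω).hasDerivWithinAt) (hM.injOn hT b)]
  refine setIntegral_congr_fun measurableSet_Ioo fun ω hω => ?_
  have h0 : |deriv T ω| ≠ 0 := (hδ.trans_le (hd b ω hω)).ne'
  simp only [smul_eq_mul]
  rw [hM.branchWeight_apply hT hω]
  field_simp

/-- Lebesgue measure is a fixed point of the transfer operator. -/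
theorem ae_sum_branchWeight (hM : IsMarkovExpanding η T) (hT : MeasurePreserving T leb leb) :
    ∀ᵐ y ∂leb, ∑ b, branchWeight η T b y = 1 := by
  refine Integrable.ae_eq_of_forall_setIntegral_eq (fun y => ∑ b, branchWeight η T b y)
    (fun _ => (1 : ℝ)) (integrable_finsetSum _ fun b _ => hM.integrable_branchWeight hT b)
    (integrable_const _) fun s hs _ => ?_
  have hind : Integrable (s.indicator fun _ => (1 : ℝ)) leb := (integrable_const _).indicator hs
  have hmul : ∀ b y, s.indicator (branchWeight η T b) y =
      branchWeight η T b y * s.indicator (fun _ => (1 : ℝ)) y := by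
    intro b y
    by_cases hy : y ∈ s <;> simp [hy]
  rw [integral_finsetSum _ fun b _ => (hM.integrable_branchWeight hT b).integrableOn]
  have hcomp : Integrable (fun ω => s.indicator (fun _ => (1 : ℝ)) (T ω)) leb :=
    hT.integrable_comp_of_integrable hind
  calc ∑ b, ∫ y in s, branchWeight η T b y ∂leb
      = ∑ b, ∫ ω in piece η b, s.indicator (fun _ => (1 : ℝ)) (T ω) := by
        refine Finset.sum_congr rfl fun b _ => ?_
        rw [← integral_indicator hs, ← hM.integral_branchWeight_mul hT b]
        exact integral_congr_ae (ae_of_all _ (hmul b))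
    _ = ∫ ω, s.indicator (fun _ => (1 : ℝ)) (T ω) ∂leb := sum_integral_piece hM.subdivision hcomp
    _ = ∫ ω, s.indicator (fun _ => (1 : ℝ)) ω ∂leb := by
        conv_rhs => rw [← hT.map_eq]
        rw [integral_map hT.measurable.aemeasurable]
        rw [hT.map_eq]
        exact hind.aestronglyMeasurable
    _ = ∫ y in s, (1 : ℝ) ∂leb := integral_indicator hs

theorem exists_mem_codeCyl_sum_branchWeight (hM : IsMarkovExpanding η T)
    (hT : MeasurePreserving T leb leb) {w : List (Fin K)} (hw : (codeCyl η T w).Nonempty) :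
    ∃ ω ∈ codeCyl η T w, ∑ b, branchWeight η T b ω = 1 := by
  by_contra h
  push Not at h
  exact hM.leb_codeCyl_pos hT hw (measure_mono_null h (hM.ae_sum_branchWeight hT))

end IsMarkovExpanding

/-! ### Contraction of cylinders -/

/-- The points of `[0,1]` that visit the pieces prescribed by `w`, whether or not they have an
infinite code. Unlike `codeCyl`, these sets are intervals. -/
def itinerary (η : Fin (K + 1) → ℝ) (T : ℝ → ℝ) : List (Fin K) → Set ℝ
  | [] => Icc 0 1
  | a :: w => piece η a ∩ T ⁻¹' itinerary η T w

section

variable {η : Fin (K + 1) → ℝ} {T : ℝ → ℝ}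

theorem iterate_mem_itinerary {w : List (Fin K)} {ω : ℝ}
    (hω : ω ∈ itinerary η T w) {k : ℕ} (hk : k ≤ w.length) :
    T^[k] ω ∈ itinerary η T (w.drop k) := by
  induction k generalizing w ω with
  | zero => exact hω
  | succ k ih =>
    cases w with
    | nil => simp at hk
    | cons a w => exact ih hω.2 (by simpa using hk)

theorem exists_mem_piece_of_itinerary {w : List (Fin K)} {ω : ℝ}
    (hω : ω ∈ itinerary η T w) {k : ℕ} (hk : k < w.length) : ∃ j, T^[k] ω ∈ piece η j := by
  have h := iterate_mem_itinerary hω hk.le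
  rw [List.drop_eq_getElem_cons hk] at h
  exact ⟨_, h.1⟩

end

namespace IsMarkovExpanding

variable {η : Fin (K + 1) → ℝ} {T : ℝ → ℝ}

theorem codeCyl_subset_itinerary (hM : IsMarkovExpanding η T) (w : List (Fin K)) :
    codeCyl η T w ⊆ itinerary η T w := by
  induction w with
  | nil => exact fun ω hω => hω.1.1
  | cons a w ih =>
    intro ω hω
    obtain ⟨-, h0, h⟩ := (mem_codeCyl_cons hM.mapsTo).1 hω
    exact ⟨h0, ih h⟩

theorem itinerary_subset_Icc (hM : IsMarkovExpanding η T) (w : List (Fin K)) :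
    itinerary η T w ⊆ Icc 0 1 := by
  cases w with
  | nil => exact subset_rfl
  | cons a w => exact inter_subset_left.trans (piece_subset_Icc hM.subdivision a)

theorem ordConnected_itinerary (hM : IsMarkovExpanding η T) (w : List (Fin K)) :
    OrdConnected (itinerary η T w) := by
  induction w with
  | nil => exact ordConnected_Icc
  | cons a w ih =>
    refine ⟨fun s hs t ht u hu => ?_⟩
    have hua : u ∈ piece η a := ordConnected_Ioo.out hs.1 ht.1 hu
    refine ⟨hua, ?_⟩
    rcases hM.monotone a with hmono | hanti
    · exact ih.out hs.2 ht.2 ⟨hmono hs.1 hua hu.1, hmono hua ht.1 hu.2⟩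
    · exact ih.out ht.2 hs.2 ⟨hanti hua ht.1 hu.2, hanti hs.1 hua hu.1⟩

/-- Points with a long common itinerary are close to each other. -/
theorem exists_contraction (hM : IsMarkovExpanding η T) :
    ∃ (m : ℕ) (c : ℝ), 1 < c ∧ ∀ (k : ℕ) (w : List (Fin K)), k * m ≤ w.length →
      ∀ s ∈ itinerary η T w, ∀ t ∈ itinerary η T w, c ^ k * |s - t| ≤ 1 := by
  obtain ⟨m, c, hm, hc, hexp⟩ := hM.expanding
  refine ⟨m, c, hc, fun k => ?_⟩
  -- by the mean value theorem, `T^m` expands distances on itineraries of length at least `m`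
  have hstep : ∀ w : List (Fin K), m ≤ w.length → ∀ s ∈ itinerary η T w, ∀ t ∈ itinerary η T w,
      s < t → c * |s - t| ≤ |T^[m] s - T^[m] t| := by
    intro w hw s hs t ht hst
    have hd : ∀ u ∈ Icc s t, DifferentiableAt ℝ T^[m] u ∧ c ≤ |deriv T^[m] u| := by
      intro u hu
      have hu' := (hM.ordConnected_itinerary w).out hs ht hu
      have hp : ∀ k < m, ∃ j, T^[k] u ∈ piece η j := fun k hk =>
        exists_mem_piece_of_itinerary hu' (hk.trans_le hw)
      have h1 := (hM.hasDerivAt_iterate m hp).differentiableAt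
      refine ⟨h1, hexp u (hM.itinerary_subset_Icc w hu') (fun k hk => ?_) h1⟩
      obtain ⟨j, hj⟩ := hp k hk
      exact notMem_range_of_mem_piece hM.subdivision hj
    obtain ⟨u, hu, hslope⟩ := exists_deriv_eq_slope T^[m] hst
      (fun u hu => (hd u hu).1.continuousAt.continuousWithinAt)
      (fun u hu => (hd u (Ioo_subset_Icc_self hu)).1.differentiableWithinAt)
    have h2 := (hd u (Ioo_subset_Icc_self hu)).2
    rw [hslope, abs_div, le_div_iff₀ (abs_pos.2 (sub_pos.2 hst).ne')] at h2
    rwa [abs_sub_comm s, abs_sub_comm (T^[m] s)]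
  have hstep' : ∀ w : List (Fin K), m ≤ w.length → ∀ s ∈ itinerary η T w, ∀ t ∈ itinerary η T w,
      c * |s - t| ≤ |T^[m] s - T^[m] t| := by
    intro w hw s hs t ht
    rcases lt_trichotomy s t with h | rfl | h
    · exact hstep w hw s hs t ht h
    · simp
    · rw [abs_sub_comm s, abs_sub_comm (T^[m] s)]
      exact hstep w hw t ht s hs h
  induction k with
  | zero =>
    intro w _ s hs t ht
    have h1 := hM.itinerary_subset_Icc w hs
    have h2 := hM.itinerary_subset_Icc w ht
    rw [pow_zero, one_mul, abs_le]
    exact ⟨by linarith [h1.1, h2.2], by linarith [h1.2, h2.1]⟩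
  | succ k ih =>
    intro w hw s hs t ht
    rw [add_mul, one_mul] at hw
    have hmw : m ≤ w.length := by omega
    have h1 := ih (w.drop m) (by rw [List.length_drop]; omega) _ (iterate_mem_itinerary hs hmw) _
      (iterate_mem_itinerary ht hmw)
    refine le_trans ?_ h1
    rw [pow_succ, mul_assoc]
    exact mul_le_mul_of_nonneg_left (hstep' w hmw s hs t ht) (by positivity)

theorem exists_dist_lt (hM : IsMarkovExpanding η T) {δ : ℝ} (hδ : 0 < δ) :
    ∃ N : ℕ, ∀ w : List (Fin K), N ≤ w.length →
      ∀ s ∈ codeCyl η T w, ∀ t ∈ codeCyl η T w, dist s t < δ := by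
  obtain ⟨m, c, hc, h⟩ := hM.exists_contraction
  obtain ⟨k, hk⟩ := pow_unbounded_of_one_lt (1 / δ) hc
  refine ⟨k * m, fun w hw s hs t ht => ?_⟩
  have h1 := h k w hw s (hM.codeCyl_subset_itinerary w hs) t (hM.codeCyl_subset_itinerary w ht)
  have hck : 0 < c ^ k := by positivity
  rw [div_lt_iff₀ hδ] at hk
  rw [Real.dist_eq]
  by_contra hcon
  have := mul_le_mul_of_nonneg_left (not_lt.1 hcon) hck.le
  linarith

/-- The inverse derivatives along points with longer and longer prescribed codes converge, to a
limit which does not depend on the points. -/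
theorem exists_tendsto_deriv (hM : IsMarkovExpanding η T) (hT : MeasurePreserving T leb leb)
    (b : Fin K) (x : Past K) : ∃ L : ℝ, ∀ ω : ℕ → ℝ,
      (∀ᶠ n in atTop, ω n ∈ codeCyl η T (b :: recent x n)) →
      Tendsto (fun n => 1 / |deriv T (ω n)|) atTop (𝓝 L) := by
  obtain ⟨δ, hδ, hd⟩ := hM.exists_le_deriv hT
  obtain ⟨g, hg, hgT⟩ := hM.exists_deriv b
  by_cases hex : ∃ ω : ℕ → ℝ, ∀ᶠ n in atTop, ω n ∈ codeCyl η T (b :: recent x n)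
  swap
  · exact ⟨0, fun ω hω => absurd ⟨ω, hω⟩ hex⟩
  obtain ⟨ω₀, hω₀⟩ := hex
  have hclose : ∀ (ω ω' : ℕ → ℝ), (∀ᶠ n in atTop, ω n ∈ codeCyl η T (b :: recent x n)) →
      (∀ᶠ n in atTop, ω' n ∈ codeCyl η T (b :: recent x n)) → ∀ r > 0,
      ∃ N, ∀ m ≥ N, ∀ n ≥ N, dist (ω m) (ω' n) < r := by
    intro ω ω' h h' r hr
    obtain ⟨N, hN⟩ := hM.exists_dist_lt hr
    obtain ⟨M, hM⟩ := eventually_atTop.1 (h.and h')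
    refine ⟨max N M, fun m hm n hn => hN (b :: recent x N) (by simp [length_recent]) _ ?_ _ ?_⟩
    · exact codeCyl_mono ((List.cons_prefix_cons.2 ⟨rfl, recent_prefix x (by omega)⟩))
        (hM m (by omega)).1
    · exact codeCyl_mono ((List.cons_prefix_cons.2 ⟨rfl, recent_prefix x (by omega)⟩))
        (hM n (by omega)).2
  have hcauchy : CauchySeq ω₀ := Metric.cauchySeq_iff.2 fun r hr => hclose ω₀ ω₀ hω₀ hω₀ r hr
  obtain ⟨t, ht⟩ := cauchySeq_tendsto_of_complete hcauchy
  have hpiece : ∀ {ω : ℕ → ℝ}, (∀ᶠ n in atTop, ω n ∈ codeCyl η T (b :: recent x n)) →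
      ∀ᶠ n in atTop, ω n ∈ piece η b := fun h =>
    h.mono fun n hn => ((mem_codeCyl_cons hM.mapsTo).1 hn).2.1
  have htI : t ∈ Icc (η b.castSucc) (η b.succ) :=
    isClosed_Icc.mem_of_tendsto ht ((hpiece hω₀).mono fun n hn => Ioo_subset_Icc_self hn)
  refine ⟨1 / |g t|, fun ω hω => ?_⟩
  have hlim : Tendsto ω atTop (𝓝 t) := by
    refine tendsto_of_tendsto_of_dist ht (Metric.tendsto_atTop.2 fun r hr => ?_)
    obtain ⟨N, hN⟩ := hclose ω₀ ω hω₀ hω r hr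
    refine ⟨N, fun n hn => ?_⟩
    rw [Real.dist_0_eq_abs, abs_of_nonneg dist_nonneg]
    exact hN n hn n hn
  have hlim' : Tendsto ω atTop (𝓝[Icc (η b.castSucc) (η b.succ)] t) :=
    tendsto_nhdsWithin_iff.2 ⟨hlim, (hpiece hω).mono fun n hn => Ioo_subset_Icc_self hn⟩
  have hgl : Tendsto (fun n => |g (ω n)|) atTop (𝓝 |g t|) := ((hg t htI).tendsto.comp hlim').abs
  have hgδ : ∀ᶠ n in atTop, δ ≤ |g (ω n)| := (hpiece hω).mono fun n hn => by
    rw [← (hgT _ hn).deriv]; exact hd b _ hn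
  have hne : |g t| ≠ 0 := (hδ.trans_le (ge_of_tendsto hgl hgδ)).ne'
  refine (tendsto_const_nhds.div hgl hne).congr' ?_
  filter_upwards [hpiece hω] with n hn
  rw [(hgT _ hn).deriv]
  rfl

end IsMarkovExpanding

/-! ### The transition probabilities -/

/-- The beginning of the word `w` that is a finite context, and `w` itself if there is none. -/
def truncate (τ : Set (PastString K)) (w : List (Fin K)) : List (Fin K) :=
  open Classical in if h : ∃ v, Sum.inl v ∈ τ ∧ v <+: w then h.choose else w

open Classical in
/-- Transition probabilities given the finite past `w`: the branch weights at a point with code `w`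
at which they sum to one, and the uniform distribution if no point has this code. -/
def wordWeight (η : Fin (K + 1) → ℝ) (T : ℝ → ℝ) (b : Fin K) (w : List (Fin K)) : ℝ :=
  if h : ∃ ω ∈ codeCyl η T w, ∑ b, branchWeight η T b ω = 1 then branchWeight η T b h.choose
  else (K : ℝ)⁻¹

section

variable {η : Fin (K + 1) → ℝ} {T : ℝ → ℝ}

theorem wordWeight_eq_inv {w : List (Fin K)}
    (hw : ¬(codeCyl η T w).Nonempty) (b : Fin K) : wordWeight η T b w = (K : ℝ)⁻¹ :=
  dif_neg fun ⟨ω, h, _⟩ => hw ⟨ω, h⟩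

theorem wordWeight_nonneg (b : Fin K) (w : List (Fin K)) : 0 ≤ wordWeight η T b w := by
  unfold wordWeight
  split_ifs with h
  · exact branchWeight_nonneg _ _
  · positivity

end

namespace IsMarkovExpanding

variable {η : Fin (K + 1) → ℝ} {T : ℝ → ℝ}

theorem exists_wordWeight_eq (hM : IsMarkovExpanding η T) (hT : MeasurePreserving T leb leb)
    {w : List (Fin K)} (hw : (codeCyl η T w).Nonempty) :
    ∃ y ∈ codeCyl η T w, ∀ b, wordWeight η T b w = branchWeight η T b y := by
  have h := hM.exists_mem_codeCyl_sum_branchWeight hT hw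
  exact ⟨h.choose, h.choose_spec.1, fun b => dif_pos h⟩

theorem sum_wordWeight (hM : IsMarkovExpanding η T) (w : List (Fin K)) :
    ∑ b, wordWeight η T b w = 1 := by
  unfold wordWeight
  split_ifs with h
  · exact h.choose_spec.2
  · rw [Finset.sum_const, Finset.card_univ, Fintype.card_fin, nsmul_eq_mul]
    exact mul_inv_cancel₀ (Nat.cast_ne_zero.2 hM.subdivision.pos.ne')

/-- If `b` can be followed by the first symbol of the word `w`, the weight of `b` given `w` is an
inverse derivative at a point with code `b w`. -/
theorem exists_wordWeight_eq_deriv (hM : IsMarkovExpanding η T) (hT : MeasurePreserving T leb leb)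
    {a b : Fin K} {w : List (Fin K)} (hab : piece η a ⊆ T '' piece η b)
    (hw : (codeCyl η T (a :: w)).Nonempty) :
    ∃ ω ∈ codeCyl η T (b :: a :: w), wordWeight η T b (a :: w) = 1 / |deriv T ω| := by
  obtain ⟨y, hy, h⟩ := hM.exists_wordWeight_eq hT hw
  obtain ⟨ω, hω, rfl⟩ := hM.exists_mem_codeCyl_cons hy
    (hab ((mem_codeCyl_cons hM.mapsTo).1 hy).2.1)
  exact ⟨ω, hω, (h b).trans (hM.branchWeight_apply hT ((mem_codeCyl_cons hM.mapsTo).1 hω).2.1)⟩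

theorem wordWeight_eq_zero (hM : IsMarkovExpanding η T) (hT : MeasurePreserving T leb leb)
    {a b : Fin K} {w : List (Fin K)} (hab : Disjoint (T '' piece η b) (piece η a))
    (hw : (codeCyl η T (a :: w)).Nonempty) : wordWeight η T b (a :: w) = 0 := by
  obtain ⟨y, hy, h⟩ := hM.exists_wordWeight_eq hT hw
  rw [h b, branchWeight_of_notMem]
  exact fun hyb => Set.disjoint_left.1 hab hyb ((mem_codeCyl_cons hM.mapsTo).1 hy).2.1

end IsMarkovExpanding

theorem isPrefix_recent_iff {x : Past K} {v : List (Fin K)} {n : ℕ} :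
    v <+: recent x n ↔ v.length ≤ n ∧ x ∈ cyl (Sum.inl v) := by
  constructor
  · intro h
    have hl : v.length ≤ n := by simpa [length_recent] using h.length_le
    refine ⟨hl, fun i hi => ?_⟩
    rw [h.getElem hi]
    simp [recent]
  · rintro ⟨hl, hx⟩
    rw [← mem_cyl_iff_recent.1 hx]
    exact recent_prefix x hl

theorem context_unique {τ : Set (PastString K)} (hτ : IsContextTree τ) {x : Past K}
    {v w : PastString K} (hv : v ∈ τ) (hw : w ∈ τ) (hxv : x ∈ cyl v) (hxw : x ∈ cyl w) : v = w := by
  by_contra h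
  exact (hτ.disjoint v hv w hw h).subset ⟨hxv, hxw⟩

theorem truncate_recent_of_mem {τ : Set (PastString K)} (hτ : IsContextTree τ) {x : Past K}
    {w : List (Fin K)} (hw : Sum.inl w ∈ τ) (hx : x ∈ cyl (Sum.inl w)) {n : ℕ}
    (hn : w.length ≤ n) : truncate τ (recent x n) = w := by
  have h : ∃ v, Sum.inl v ∈ τ ∧ v <+: recent x n := ⟨w, hw, isPrefix_recent_iff.2 ⟨hn, hx⟩⟩
  rw [truncate, dif_pos h]
  exact Sum.inl.inj (context_unique hτ h.choose_spec.1 hw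
    (isPrefix_recent_iff.1 h.choose_spec.2).2 hx)

theorem truncate_recent_of_forall {τ : Set (PastString K)} {x : Past K}
    (hx : ∀ w, Sum.inl w ∈ τ → x ∉ cyl (Sum.inl w)) (n : ℕ) :
    truncate τ (recent x n) = recent x n := by
  refine dif_neg ?_
  rintro ⟨v, hv, h⟩
  exact hx v hv (isPrefix_recent_iff.1 h).2

/-- The truncation of the recent past begins with the most recent symbol, since contexts are not
empty. -/
theorem exists_truncate_recent {τ : Set (PastString K)} (hτ : IsContextTree τ) (x : Past K) {n : ℕ}
    (hn : 1 ≤ n) : ∃ v, truncate τ (recent x n) = x 0 :: v ∧ x 0 :: v <+: recent x n := by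
  by_cases hx : ∃ v, Sum.inl v ∈ τ ∧ v <+: recent x n
  · rw [truncate, dif_pos hx]
    obtain ⟨v, hv⟩ := eq_head_cons_of_mem_cyl (hτ.length_pos _ hx.choose_spec.1)
      (isPrefix_recent_iff.1 hx.choose_spec.2).2
    exact ⟨v, hv, hv ▸ hx.choose_spec.2⟩
  · rw [truncate, dif_neg hx]
    obtain ⟨k, rfl⟩ : ∃ k, n = k + 1 := ⟨n - 1, by omega⟩
    exact ⟨_, recent_succ x k, by rw [recent_succ]⟩

theorem measurable_comp_recent {β : Type*} [MeasurableSpace β] (f : List (Fin K) → β) (n : ℕ) :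
    Measurable fun x : Past K => f (recent x n) := by
  have h : Measurable fun x : Past K => fun i : Fin n => x i :=
    measurable_pi_iff.2 fun i => measurable_pi_apply _
  exact (Measurable.of_discrete (f := fun u : Fin n → Fin K => f (List.ofFn u))).comp h

namespace IsMarkovExpanding

variable {η : Fin (K + 1) → ℝ} {T : ℝ → ℝ} {τ : Set (PastString K)}

theorem exists_tendsto_wordWeight (hM : IsMarkovExpanding η T) (hT : MeasurePreserving T leb leb)
    (hτ : IsContextTree τ) (b : Fin K) (x : Past K) :
    ∃ L, Tendsto (fun n => wordWeight η T b (truncate τ (recent x n))) atTop (𝓝 L) := by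
  by_cases hx : ∃ w, Sum.inl w ∈ τ ∧ x ∈ cyl (Sum.inl w)
  · obtain ⟨w, hw, hx⟩ := hx
    refine ⟨wordWeight η T b w, tendsto_const_nhds.congr' ?_⟩
    filter_upwards [eventually_ge_atTop w.length] with n hn
    rw [truncate_recent_of_mem hτ hw hx hn]
  push Not at hx
  simp only [truncate_recent_of_forall hx]
  by_cases hadm : ∀ n, (codeCyl η T (recent x n)).Nonempty
  · rcases hM.subset_image_or_disjoint b (x 0) with hab | hab
    · have hex : ∀ n, ∃ ω ∈ codeCyl η T (b :: recent x (n + 1)),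
          wordWeight η T b (recent x (n + 1)) = 1 / |deriv T ω| := by
        intro n
        have := hadm (n + 1)
        rw [recent_succ] at this ⊢
        exact hM.exists_wordWeight_eq_deriv hT hab this
      choose ω hω hL using hex
      obtain ⟨L, h⟩ := hM.exists_tendsto_deriv hT b x
      refine ⟨L, (h (fun n => ω (n - 1)) ?_).congr' ?_⟩
      · filter_upwards [eventually_ge_atTop 1] with n hn
        have := hω (n - 1)
        rwa [Nat.sub_add_cancel hn] at this
      · filter_upwards [eventually_ge_atTop 1] with n hn
        have := hL (n - 1)
        rw [Nat.sub_add_cancel hn] at this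
        exact this.symm
    · refine ⟨0, tendsto_const_nhds.congr' ?_⟩
      filter_upwards [eventually_ge_atTop 1] with n hn
      obtain ⟨k, rfl⟩ : ∃ k, n = k + 1 := ⟨n - 1, by omega⟩
      have := hadm (k + 1)
      rw [recent_succ] at this ⊢
      exact (hM.wordWeight_eq_zero hT hab this).symm
  · push Not at hadm
    obtain ⟨m, hm⟩ := hadm
    refine ⟨(K : ℝ)⁻¹, tendsto_const_nhds.congr' ?_⟩
    filter_upwards [eventually_ge_atTop m] with n hn
    refine (wordWeight_eq_inv (fun h => ?_) b).symm
    rw [← not_nonempty_iff_eq_empty] at hm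
    exact hm (h.mono (codeCyl_mono (recent_prefix x hn)))

/-- The family of transition probabilities of a Markov expanding map with property (V). -/
theorem exists_transitionFamily (hM : IsMarkovExpanding η T) (hT : MeasurePreserving T leb leb)
    (hτ : IsContextTree τ) (hV : DerivConstOnContexts η T τ) :
    ∃ p : Fin K → Past K → ℝ, IsTransitionFamily p ∧ IsAssociatedFamily η T p ∧
      HasVariableLength τ p := by
  choose p hp using fun b x => hM.exists_tendsto_wordWeight hT hτ b x
  have hsum : ∀ x, ∑ a, p a x = 1 := fun x =>
    tendsto_nhds_unique (tendsto_finsetSum _ fun a _ => hp a x)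
      (tendsto_const_nhds.congr fun n => (hM.sum_wordWeight _).symm)
  have hnn : ∀ a x, 0 ≤ p a x := fun a x => ge_of_tendsto' (hp a x) fun n => wordWeight_nonneg _ _
  have hfam : IsTransitionFamily p := by
    refine ⟨fun a x => ⟨hnn a x, ?_⟩, hsum, fun a => ?_⟩
    · rw [← hsum x]
      exact Finset.single_le_sum (f := fun a => p a x) (fun b _ => hnn b x) (Finset.mem_univ a)
    · exact measurable_of_tendsto_metrizable
        (fun n => measurable_comp_recent (fun w => wordWeight η T a (truncate τ w)) n)
        (tendsto_pi_nhds.2 fun x => hp a x)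
  refine ⟨p, hfam, fun a hadm b => ⟨fun ω hω => ?_, ?_⟩, ?_⟩
  · have hab : piece η (a 0) ⊆ T '' piece η b := by
      have h := hω 1
      rw [recent_succ] at h
      obtain ⟨-, h1, h2⟩ := (mem_codeCyl_cons hM.mapsTo).1 h
      exact (hM.subset_image_or_disjoint b (a 0)).resolve_right fun h =>
        Set.disjoint_left.1 h (mem_image_of_mem T h1) ((mem_codeCyl_cons hM.mapsTo).1 h2).2.1
    have hex : ∀ n, 1 ≤ n → ∃ ω ∈ codeCyl η T (b :: truncate τ (recent a n)),
        wordWeight η T b (truncate τ (recent a n)) = 1 / |deriv T ω| := by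
      intro n hn
      obtain ⟨v, hv, hpre⟩ := exists_truncate_recent hτ a hn
      rw [hv]
      exact hM.exists_wordWeight_eq_deriv hT hab ((hadm n).mono (codeCyl_mono hpre))
    by_cases hx : ∃ w, Sum.inl w ∈ τ ∧ a ∈ cyl (Sum.inl w)
    · obtain ⟨w, hw, hx⟩ := hx
      refine (hp b a).congr' ?_
      filter_upwards [eventually_ge_atTop w.length] with n hn
      obtain ⟨ω', hω', h⟩ := hex n ((hτ.length_pos w hw).trans hn)
      rw [truncate_recent_of_mem hτ hw hx hn] at hω'
      have hωw : ω n ∈ codeCyl η T (b :: w) := codeCyl_mono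
        (List.cons_prefix_cons.2 ⟨rfl, isPrefix_recent_iff.2 ⟨hn, hx⟩⟩) (hω n)
      rw [h, hV w hw b _ hω' _ hωw]
    · push Not at hx
      simp only [truncate_recent_of_forall hx] at hex
      have hex' : ∀ n, ∃ ω, 1 ≤ n → ω ∈ codeCyl η T (b :: recent a n) ∧
          wordWeight η T b (recent a n) = 1 / |deriv T ω| := by
        intro n
        by_cases hn : 1 ≤ n
        · obtain ⟨ω, h⟩ := hex n hn
          exact ⟨ω, fun _ => h⟩
        · exact ⟨0, fun h => absurd h hn⟩
      choose ω' hω' using hex'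
      obtain ⟨L, hL⟩ := hM.exists_tendsto_deriv hT b a
      have h1 := hL ω (Eventually.of_forall hω)
      have h2 := hL ω' ((eventually_ge_atTop 1).mono fun n hn => (hω' n hn).1)
      have h3 := hp b a
      simp only [truncate_recent_of_forall hx] at h3
      have h4 := h3.congr' ((eventually_ge_atTop 1).mono fun n hn => (hω' n hn).2)
      rwa [tendsto_nhds_unique h4 h2]
  · rintro ⟨n, hn⟩
    have hdisj : Disjoint (T '' piece η b) (piece η (a 0)) := by
      refine (hM.subset_image_or_disjoint b (a 0)).resolve_left fun h => ?_
      have h1 := hadm (n + 1)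
      rw [recent_succ] at h1
      obtain ⟨y, hy⟩ := h1
      obtain ⟨ω, hω, -⟩ := hM.exists_mem_codeCyl_cons hy (h ((mem_codeCyl_cons hM.mapsTo).1 hy).2.1)
      rw [← recent_succ] at hω
      have := codeCyl_mono (List.cons_prefix_cons.2 ⟨rfl, recent_prefix a n.le_succ⟩) hω
      rw [hn] at this
      exact this
    refine tendsto_nhds_unique (hp b a) (tendsto_const_nhds.congr' ?_)
    filter_upwards [eventually_ge_atTop 1] with m hm
    obtain ⟨v, hv, hpre⟩ := exists_truncate_recent hτ a hm
    rw [hv]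
    exact (hM.wordWeight_eq_zero hT hdisj ((hadm m).mono (codeCyl_mono hpre))).symm
  · -- on a cylinder of the tree the family is constant
    have hconst : ∀ w ∈ τ, ∀ x ∈ cyl w, ∀ y ∈ cyl w, ∀ a, p a x = p a y := by
      rintro (w | z) hw x hx y hy a
      · have key : ∀ x ∈ cyl (Sum.inl w), p a x = wordWeight η T a w := by
          intro x hx
          refine tendsto_nhds_unique (hp a x) (tendsto_const_nhds.congr' ?_)
          filter_upwards [eventually_ge_atTop w.length] with n hn
          rw [truncate_recent_of_mem hτ hw hx hn]
        rw [key x hx, key y hy]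
      · rw [show x = z from hx, show y = z from hy]
    have hne : ∀ w : PastString K, (cyl w).Nonempty := by
      rintro (w | z)
      · exact ⟨_, app_mem_cyl w (botPast hM.subdivision.pos)⟩
      · exact ⟨z, rfl⟩
    choose x hx using hne
    refine ⟨fun w => PMF.ofFintype (fun a => ENNReal.ofReal (p a (x w.1))) ?_, fun w y hy a => ?_⟩
    · rw [← ENNReal.ofReal_sum_of_nonneg fun a _ => hnn a _, hsum, ENNReal.ofReal_one]
    · rw [PMF.ofFintype_apply, ENNReal.toReal_ofReal (hnn a _)]
      exact hconst w.1 w.2 y hy _ (hx w.1) a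

end IsMarkovExpanding

/-! ### Codes as random variables -/

open Classical in
/-- The index of the piece that contains `ω`, and `j₀` if there is none. -/
def pieceIndex (η : Fin (K + 1) → ℝ) (j₀ : Fin K) (ω : ℝ) : Fin K :=
  if h : ∃ j, ω ∈ piece η j then h.choose else j₀

/-- The code of `ω`, written as a past; its symbols are `j₀` where the orbit is in no piece. -/
def code (η : Fin (K + 1) → ℝ) (T : ℝ → ℝ) (j₀ : Fin K) (ω : ℝ) : Past K :=
  fun n => pieceIndex η j₀ (T^[n] ω)

theorem pieceIndex_eq {η : Fin (K + 1) → ℝ} (hη : IsSubdivision η) {j₀ j : Fin K} {ω : ℝ}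
    (h : ω ∈ piece η j) : pieceIndex η j₀ ω = j := by
  have hex : ∃ j, ω ∈ piece η j := ⟨j, h⟩
  rw [pieceIndex, dif_pos hex]
  exact eq_of_mem_piece hη hex.choose_spec h

theorem measurable_pieceIndex {η : Fin (K + 1) → ℝ} (hη : IsSubdivision η) (j₀ : Fin K) :
    Measurable (pieceIndex η j₀) := by
  refine measurable_to_countable' fun j => ?_
  have h : pieceIndex η j₀ ⁻¹' {j} = piece η j ∪ ((⋃ i, piece η i)ᶜ ∩ {_ω | j₀ = j}) := by
    ext ω
    by_cases hex : ∃ i, ω ∈ piece η i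
    · obtain ⟨i, hi⟩ := hex
      have hU : ω ∈ ⋃ i, piece η i := mem_iUnion.2 ⟨i, hi⟩
      rw [mem_preimage, pieceIndex_eq hη hi, mem_singleton_iff]
      constructor
      · rintro rfl; exact Or.inl hi
      · rintro (h | h)
        · exact eq_of_mem_piece hη hi h
        · exact absurd hU h.1
    · rw [mem_preimage, pieceIndex, dif_neg hex, mem_singleton_iff]
      constructor
      · exact fun h => Or.inr ⟨fun hU => hex (mem_iUnion.1 hU), h⟩
      · rintro (h | h)
        · exact absurd ⟨j, h⟩ hex
        · exact h.2
  rw [h]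
  exact measurableSet_Ioo.union
    ((MeasurableSet.iUnion fun i => measurableSet_Ioo).compl.inter (MeasurableSet.const _))

theorem measurable_code {η : Fin (K + 1) → ℝ} {T : ℝ → ℝ} (hη : IsSubdivision η)
    (hT : Measurable T) (j₀ : Fin K) : Measurable (code η T j₀) :=
  measurable_pi_iff.2 fun n => (measurable_pieceIndex hη j₀).comp (hT.iterate n)

theorem code_iterate {η : Fin (K + 1) → ℝ} {T : ℝ → ℝ} (j₀ : Fin K) (k n : ℕ) (ω : ℝ) :
    code η T j₀ (T^[k] ω) n = code η T j₀ ω (k + n) := by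
  rw [code, code, ← Function.iterate_add_apply, add_comm]

namespace IsMarkovExpanding

variable {η : Fin (K + 1) → ℝ} {T : ℝ → ℝ}

theorem code_mem_cyl (hM : IsMarkovExpanding η T) {j₀ : Fin K} {ω : ℝ} (hω : ω ∈ codable η T)
    {w : List (Fin K)} : code η T j₀ ω ∈ cyl (Sum.inl w) ↔ ω ∈ codeCyl η T w := by
  have hp : ∀ n, T^[n] ω ∈ piece η (code η T j₀ ω n) := by
    intro n
    have h := codable_iterate hM.subdivision hM.mapsTo hω n
    obtain ⟨j, hj⟩ := exists_mem_piece hM.subdivision h.1 (h.2 0)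
    rwa [code, pieceIndex_eq hM.subdivision hj]
  constructor
  · intro h
    refine ⟨hω, fun i hi => ?_⟩
    rw [← h i hi]
    exact hp i
  · rintro ⟨-, h⟩ i hi
    exact eq_of_mem_piece hM.subdivision (hp i) (h i hi)

theorem mem_codeCyl_recent_code (hM : IsMarkovExpanding η T) {j₀ : Fin K} {ω : ℝ}
    (hω : ω ∈ codable η T) (n : ℕ) : ω ∈ codeCyl η T (recent (code η T j₀ ω) n) :=
  (hM.code_mem_cyl hω).1 (mem_cyl_recent.2 fun _ _ => rfl)

theorem code_eq_consPast (hM : IsMarkovExpanding η T) {j₀ b : Fin K} {ω : ℝ}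
    (hω : ω ∈ piece η b) : code η T j₀ ω = consPast b (code η T j₀ (T ω)) := by
  funext n
  cases n with
  | zero => exact pieceIndex_eq hM.subdivision hω
  | succ n => rfl

theorem leb_code_preimage (hM : IsMarkovExpanding η T) (hT : MeasurePreserving T leb leb)
    (j₀ : Fin K) (w : List (Fin K)) :
    leb (code η T j₀ ⁻¹' cyl (Sum.inl w)) = leb (codeCyl η T w) := by
  refine measure_congr ?_
  filter_upwards [ae_codable (η := η) hT] with ω hω
  exact propext (hM.code_mem_cyl hω)

end IsMarkovExpanding

/-! ### The chain of a map -/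

theorem IsChainLaw.apply_window {η : Fin (K + 1) → ℝ} {T : ℝ → ℝ} {P : Measure (ℤ → Fin K)}
    (hP : IsChainLaw η T P) (n : ℤ) (L : ℕ) (u : ℕ → Fin K) :
    P {z | ∀ i < L, z (n - i) = u i} = leb (codeCyl η T (recent u L)) := by
  rw [← hP n]
  congr 1
  ext z
  simp [recent]

theorem IsChainLaw.stationary {η : Fin (K + 1) → ℝ} {T : ℝ → ℝ} {P : Measure (ℤ → Fin K)}
    [IsProbabilityMeasure P] (hP : IsChainLaw η T P) : Stationary P := by
  have hS : Measurable fun (z : ℤ → Fin K) (i : ℤ) => z (i - 1) :=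
    measurable_pi_iff.2 fun i => measurable_pi_apply _
  have hmap : IsProbabilityMeasure (P.map fun (z : ℤ → Fin K) (i : ℤ) => z (i - 1)) :=
    Measure.isProbabilityMeasure_map hS.aemeasurable
  refine ⟨hS, measure_ext_of_cylinders (fun N : ℕ => Finset.Icc (-(N : ℤ)) N)
    (fun m n h => Finset.Icc_subset_Icc (by simpa using h) (by simpa using h))
    (fun i => ⟨i.natAbs, Finset.mem_Icc.2 (by omega)⟩) (by simp) fun N v => ?_⟩
  -- both sides are probabilities that a window of length `2 N + 1` shows the symbols of `v`
  have hset : ∀ n : ℤ, {z : ℤ → Fin K | ∀ i ∈ Finset.Icc (-(N : ℤ)) N, z (i - n) = v i} =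
      {z | ∀ i < 2 * N + 1, z (N - n - (i : ℕ)) = v (N - (i : ℕ))} := by
    intro n
    ext z
    constructor
    · intro h i hi
      have := h (N - i) (Finset.mem_Icc.2 (by omega))
      rwa [show (N : ℤ) - i - n = N - n - i by ring] at this
    · intro h i hi
      rw [Finset.mem_Icc] at hi
      have := h (N - i).toNat (by omega)
      rw [show ((N - i).toNat : ℤ) = N - i by omega] at this
      rwa [show (N : ℤ) - n - (N - i) = i - n by ring, show (N : ℤ) - (N - i) = i by ring] at this
  have hmeas : MeasurableSet {z : ℤ → Fin K | ∀ i ∈ Finset.Icc (-(N : ℤ)) N, z i = v i} := by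
    have : {z : ℤ → Fin K | ∀ i ∈ Finset.Icc (-(N : ℤ)) N, z i = v i} =
        ⋂ i ∈ Finset.Icc (-(N : ℤ)) N, (fun z => z i) ⁻¹' {v i} := by
      ext z; simp
    rw [this]
    exact Finset.measurableSet_biInter _ fun i _ =>
      measurable_pi_apply i (measurableSet_singleton _)
  have h1 := hset 1
  have h0 := hset 0
  simp only [sub_zero] at h0
  rw [Measure.map_apply hS hmeas]
  change P {z : ℤ → Fin K | ∀ i ∈ Finset.Icc (-(N : ℤ)) N, z (i - 1) = v i} = _
  rw [h1, h0, hP.apply_window _ _ fun i => v (N - (i : ℕ)),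
    hP.apply_window _ _ fun i => v (N - (i : ℕ))]

namespace IsMarkovExpanding

variable {η : Fin (K + 1) → ℝ} {T : ℝ → ℝ} {τ : Set (PastString K)}

/-- The chain exists: it is a limit point of the laws of the reversed codes which start at time `n`,
as `n` tends to infinity. By invariance, these laws give the same probability to a cylinder from
some `n` on. -/
theorem exists_isChainLaw (hM : IsMarkovExpanding η T) (hT : MeasurePreserving T leb leb) :
    ∃ P : Measure (ℤ → Fin K), IsProbabilityMeasure P ∧ IsChainLaw η T P := by
  let j₀ : Fin K := ⟨0, hM.subdivision.pos⟩
  let φ : ℕ → ℝ → ℤ → Fin K := fun n ω i => code η T j₀ ω (n - i).toNat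
  have hφ : ∀ n, Measurable (φ n) := fun n => measurable_pi_iff.2 fun i =>
    (measurable_pi_apply _).comp (measurable_code hM.subdivision hT.measurable j₀)
  let μ : ℕ → ProbabilityMeasure (ℤ → Fin K) := fun n =>
    ⟨leb.map (φ n), Measure.isProbabilityMeasure_map (hφ n).aemeasurable⟩
  obtain ⟨P, hP⟩ : ∃ P, Tendsto μ (hyperfilter ℕ : Filter ℕ) (𝓝 P) :=
    ⟨_, Ultrafilter.le_nhds_lim ((hyperfilter ℕ).map μ)⟩
  refine ⟨P, inferInstance, fun m w => ?_⟩
  set A : Set (ℤ → Fin K) := {z | ∀ (i : ℕ) (hi : i < w.length), z (m - i) = w[i]} with hA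
  have hAeq : A = (fun (z : ℤ → Fin K) (i : ℕ) => z (m - i)) ⁻¹' cyl (Sum.inl w) := rfl
  have hAclopen : IsClopen A := by
    rw [hAeq]
    exact (isClopen_cyl w).preimage (continuous_pi fun i => continuous_apply _)
  have hlim : Tendsto (fun n => (μ n : Measure (ℤ → Fin K)) A) (hyperfilter ℕ : Filter ℕ)
      (𝓝 ((P : Measure (ℤ → Fin K)) A)) :=
    ProbabilityMeasure.tendsto_measure_of_null_frontier_of_tendsto' hP
      (by rw [hAclopen.frontier_eq]; exact measure_empty)
  refine tendsto_nhds_unique hlim (tendsto_const_nhds.congr' ?_)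
  have hle : (hyperfilter ℕ : Filter ℕ) ≤ atTop := by
    rw [← Nat.cofinite_eq_atTop]
    exact hyperfilter_le_cofinite
  refine hle ?_
  filter_upwards [eventually_ge_atTop m.toNat] with n hn
  change _ = leb.map (φ n) A
  obtain ⟨k, hk⟩ : ∃ k : ℕ, (n : ℤ) = m + k := ⟨(n - m).toNat, by omega⟩
  rw [Measure.map_apply (hφ n) hAclopen.isClosed.measurableSet]
  have hpre : φ n ⁻¹' A = T^[k] ⁻¹' (code η T j₀ ⁻¹' cyl (Sum.inl w)) := by
    ext ω
    rw [hAeq]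
    simp only [mem_preimage]
    have : (fun i : ℕ => φ n ω (m - i)) = code η T j₀ (T^[k] ω) := by
      funext i
      rw [code_iterate]
      simp only [φ]
      congr 1
      omega
    rw [this]
  rw [hpre, (hT.iterate k).measure_preimage
    ((measurable_code hM.subdivision hT.measurable j₀) (measurableSet_cyl w)).nullMeasurableSet,
    hM.leb_code_preimage hT]

theorem map_past0_eq (hM : IsMarkovExpanding η T) (hT : MeasurePreserving T leb leb)
    {P : Measure (ℤ → Fin K)} [IsProbabilityMeasure P] (hP : IsChainLaw η T P) (j₀ : Fin K) :
    P.map past0 = leb.map (code η T j₀) := by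
  have : IsProbabilityMeasure (P.map past0) :=
    Measure.isProbabilityMeasure_map measurable_past0.aemeasurable
  refine measure_ext_of_cyl fun w => ?_
  rw [Measure.map_apply measurable_past0 (measurableSet_cyl w),
    Measure.map_apply (measurable_code hM.subdivision hT.measurable j₀) (measurableSet_cyl w),
    hM.leb_code_preimage hT, ← hP 0 w]
  simp [past0, cyl]

/-- Given the code `code y` of a point, the symbol `b` has as its probability the weight of the
preimage of `y` in the piece `b`. -/
theorem apply_code (hM : IsMarkovExpanding η T) (hT : MeasurePreserving T leb leb)
    {p : Fin K → Past K → ℝ} (hp : IsAssociatedFamily η T p) {j₀ : Fin K} {y : ℝ}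
    (hy : y ∈ codable η T) (b : Fin K) : p b (code η T j₀ y) = branchWeight η T b y := by
  obtain ⟨h1, h2⟩ := hp (code η T j₀ y) (fun n => ⟨y, hM.mem_codeCyl_recent_code hy n⟩) b
  by_cases hyb : y ∈ T '' piece η b
  · obtain ⟨ω, hω, rfl⟩ := hyb
    have h3 := h1 (fun _ => ω) fun n => (mem_codeCyl_cons hM.mapsTo).2
      ⟨codable_of_apply hM.subdivision hω hy, hω, hM.mem_codeCyl_recent_code hy n⟩
    rw [hM.branchWeight_apply hT hω]
    exact tendsto_nhds_unique h3 tendsto_const_nhds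
  · rw [branchWeight_of_notMem hyb]
    refine h2 ⟨1, eq_empty_of_forall_notMem fun ω hω => hyb ?_⟩
    obtain ⟨-, hωb, hTω⟩ := (mem_codeCyl_cons hM.mapsTo).1 hω
    rw [recent_succ] at hTω
    obtain ⟨i, hi⟩ := exists_mem_piece hM.subdivision hy.1 (hy.2 0)
    have h3 := ((mem_codeCyl_cons hM.mapsTo).1 hTω).2.1
    have hcode : (code η T j₀ y) 0 = i := pieceIndex_eq hM.subdivision hi
    rw [hcode] at h3
    exact (hM.subset_image_or_disjoint b i).resolve_right
      (fun h => Set.disjoint_left.1 h (mem_image_of_mem T hωb) h3) hi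

theorem invariantFor (hM : IsMarkovExpanding η T) (hT : MeasurePreserving T leb leb)
    {P : Measure (ℤ → Fin K)} [IsProbabilityMeasure P] (hP : IsChainLaw η T P)
    {p : Fin K → Past K → ℝ} (hfam : IsTransitionFamily p) (hp : IsAssociatedFamily η T p) :
    InvariantFor p P := by
  intro f hf
  let j₀ : Fin K := ⟨0, hM.subdivision.pos⟩
  have hW := measurable_code hM.subdivision hT.measurable j₀
  have hfm : Measurable f := hf.measurable
  obtain ⟨C, hC⟩ := isCompact_univ.exists_bound_of_continuousOn hf.continuousOn
  have hfint : Integrable (fun ω => f (code η T j₀ ω)) leb :=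
    Integrable.of_bound (hfm.comp hW).aestronglyMeasurable C
      (ae_of_all _ fun ω => hC _ (mem_univ _))
  have hterm : ∀ a, Integrable
      (fun y => branchWeight η T a y * f (consPast a (code η T j₀ y))) leb := fun a =>
    (hM.integrable_branchWeight hT a).mul_bdd
      (hfm.comp ((measurable_consPast a).comp hW)).aestronglyMeasurable
      (ae_of_all _ fun y => hC _ (mem_univ _))
  have hg : Measurable fun x : Past K => ∑ a, p a x * f (consPast a x) :=
    Finset.measurable_sum _ fun a _ =>
      (hfam.measurable a).mul (hfm.comp (measurable_consPast a))
  have h0 := hM.map_past0_eq hT hP j₀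
  calc ∫ z, f (past0 z) ∂P
      = ∫ ω, f (code η T j₀ ω) ∂leb := by
        rw [← integral_map measurable_past0.aemeasurable hfm.aestronglyMeasurable, h0,
          integral_map hW.aemeasurable hfm.aestronglyMeasurable]
    _ = ∑ a, ∫ ω in piece η a, f (code η T j₀ ω) := (sum_integral_piece hM.subdivision hfint).symm
    _ = ∑ a, ∫ y, branchWeight η T a y * f (consPast a (code η T j₀ y)) ∂leb := by
        refine Finset.sum_congr rfl fun a _ => ?_
        rw [hM.integral_branchWeight_mul hT a]
        refine setIntegral_congr_fun measurableSet_Ioo fun ω hω => ?_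
        rw [hM.code_eq_consPast hω]
    _ = ∫ y, ∑ a, branchWeight η T a y * f (consPast a (code η T j₀ y)) ∂leb :=
        (integral_finsetSum _ fun a _ => hterm a).symm
    _ = ∫ y, ∑ a, p a (code η T j₀ y) * f (consPast a (code η T j₀ y)) ∂leb := by
        refine integral_congr_ae ?_
        filter_upwards [ae_codable (η := η) hT] with y hy
        exact Finset.sum_congr rfl fun a _ => by rw [hM.apply_code hT hp hy]
    _ = ∫ z, ∑ a, p a (past1 z) * f (consPast a (past1 z)) ∂P := by
        rw [← integral_map hW.aemeasurable hg.aestronglyMeasurable, ← h0, ← hP.stationary.map_past1,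
          integral_map measurable_past1.aemeasurable hg.aestronglyMeasurable]

theorem finiteContextsAS (hM : IsMarkovExpanding η T) (hT : MeasurePreserving T leb leb)
    {P : Measure (ℤ → Fin K)} [IsProbabilityMeasure P] (hP : IsChainLaw η T P)
    (hτ : IsContextTree τ) (hfull : FiniteContextsFull η T τ) : FiniteContextsAS τ P := by
  let j₀ : Fin K := ⟨0, hM.subdivision.pos⟩
  have hmeas : MeasurableSet (⋃ w : {w : List (Fin K) // Sum.inl w ∈ τ}, cyl (Sum.inl w.1)) :=
    MeasurableSet.iUnion fun w => measurableSet_cyl _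
  have h1 : P (past1 ⁻¹' ⋃ w : {w : List (Fin K) // Sum.inl w ∈ τ}, cyl (Sum.inl w.1)) = 1 := by
    have hW := measurable_code hM.subdivision hT.measurable j₀
    rw [← Measure.map_apply measurable_past1 hmeas, hP.stationary.map_past1,
      hM.map_past0_eq hT hP j₀, measure_iUnion (disjoint_cyl hτ) fun w => measurableSet_cyl _,
      ← hfull]
    refine tsum_congr fun w => ?_
    rw [Measure.map_apply hW (measurableSet_cyl _), hM.leb_code_preimage hT]
  rw [← prob_compl_eq_zero_iff (measurable_past1 hmeas)] at h1
  have h2 : ∀ᵐ z ∂P, z ∈ past1 ⁻¹' ⋃ w : {w : List (Fin K) // Sum.inl w ∈ τ}, cyl (Sum.inl w.1) :=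
    h1
  filter_upwards [h2] with z hz
  obtain ⟨w, hw⟩ := mem_iUnion.1 hz
  exact ⟨w.1, w.2, hw⟩

end IsMarkovExpanding

end VLChain

end

theorem mainTheorem3 :
    (∀ (K : ℕ) (η : Fin (K + 1) → ℝ) (T : ℝ → ℝ) (τ : Set (VLChain.PastString K)),
      VLChain.IsMarkovExpanding η T →
      Ergodic T VLChain.leb →
      VLChain.IsContextTree τ →
      VLChain.FiniteContextsFull η T τ →
      VLChain.DerivConstOnContexts η T τ →
      ∃ (P : Measure (ℤ → Fin K)) (p : Fin K → VLChain.Past K → ℝ),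
        IsProbabilityMeasure P ∧ VLChain.Stationary P ∧ VLChain.IsChainLaw η T P ∧
        VLChain.IsTransitionFamily p ∧ VLChain.InvariantFor p P ∧
        VLChain.IsAssociatedFamily η T p ∧
        VLChain.HasVariableLength τ p ∧ VLChain.FiniteContextsAS τ P) ∧
    (∀ (K : ℕ), 2 ≤ K →
      ∀ (p : Fin K → VLChain.Past K → ℝ) (τ : Set (VLChain.PastString K))
        (P : Measure (ℤ → Fin K)),
      VLChain.IsTransitionFamily p →
      VLChain.NonNull p →
      VLChain.IsContextTree τ →
      VLChain.HasVariableLength τ p →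
      IsProbabilityMeasure P →
      VLChain.Stationary P →
      VLChain.InvariantFor p P →
      VLChain.FiniteContextsAS τ P →
      VLChain.IsSubdivision (VLChain.chainSubdiv P) ∧
      (∃ T : ℝ → ℝ, VLChain.IsAssociatedMap P T) ∧
      ∀ T : ℝ → ℝ, VLChain.IsAssociatedMap P T →
        (∀ j, StrictMonoOn T (VLChain.piece (VLChain.chainSubdiv P) j)) ∧
        VLChain.IsPiecewiseAffine (Fin K × {w : List (Fin K) // Sum.inl w ∈ τ}) T ∧
        (∀ w : List (Fin K), Sum.inl w ∈ τ → ∀ a : Fin K,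
          ∀ ω ∈ VLChain.codeCyl (VLChain.chainSubdiv P) T (a :: w), DifferentiableAt ℝ T ω) ∧
        VLChain.DerivConstOnContexts (VLChain.chainSubdiv P) T τ ∧
        VLChain.FiniteContextsFull (VLChain.chainSubdiv P) T τ) :=  by
  refine ⟨fun K η T τ hM hE hτ hfull hV => ?_, fun K hK p τ P hp hnn hτ hvl hP hs hinv hfin =>
    VLChain.map_of_chain hK τ hp hnn hτ hvl hP hs hinv hfin⟩
  have hT := hE.toMeasurePreserving
  obtain ⟨P, hP, hlaw⟩ := hM.exists_isChainLaw hT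
  obtain ⟨p, hfam, hassoc, hvl⟩ := hM.exists_transitionFamily hT hτ hV
  exact ⟨P, p, hP, hlaw.stationary, hlaw, hfam, hM.invariantFor hT hlaw hfam hassoc, hassoc, hvl,
    hM.finiteContextsAS hT hlaw hτ hfull⟩
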